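/- Let $\mathfrak H$ be a complex Hilbert space; inner products are linear in the first slot, and operators are identified with their graphs, i.e. with linear relations (subspaces of $\mathfrak H\times\mathfrak H$). The adjoint of a relation $S$ is $S^*=\{\{g,g'\}:(f',g)=(f,g')\text{ for all }\{f,f'\}\in S\}$. A relation $B$ is dissipative if $\operatorname{Im}(f',f)\le 0$ for all $\{f,f'\}\in B$, and maximal dissipative if it has no proper dissipative extension (among linear relations) in $\mathfrak H$. A boundary triplet $\{\mathbb C^n,\Gamma_0,\Gamma_1\}$ for $S^*$ consists of linear maps $\Gamma_0,\Gamma_1:S^*\to\mathbb C^n$ such that $(f',g)-(f,g')=(\Gamma_1\hat f,\Gamma_0\hat g)-(\Gamma_0\hat f,\Gamma_1\hat g)$ for all $\hat f=\{f,f'\},\hat g=\{g,g'\}\in S^*$ and $(\Gamma_0,\Gamma_1):S^*\to\mathbb C^n\oplus\mathbb C^n$ is surjective. Let $A$ be a selfadjoint operator and $B$ a maximal dissipative operator in $\mathfrak H$ such that, for some $\lambda\in\rho(A)\cap\rho(B)$, the operator $(B-\lambda)^{-1}-(A-\lambda)^{-1}$ has range of dimension $n\in\mathbb N$. Let $S=A\cap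 B$, let $\{\mathbb C^n,\Gamma_0,\Gamma_1\}$ be a boundary triplet for $S^*$, and let $D$ be a dissipative $n\times n$ matrix with $\ker(\operatorname{Im}D)=\{0\}$ such that $A=\ker\Gamma_0$ and $B=\ker(\Gamma_1-D\Gamma_0)$; here $\operatorname{Re}D=\frac12(D+D^*)$ and $\operatorname{Im}D=\frac1{2i}(D-D^*)$. Let $T$ be the operator $Tg=-ig'$ in $L^2(\mathbb R,\mathbb C^n)$ with domain $\{g\in W^1_2(\mathbb R,\mathbb C^n):g(0)=0\}$, let $T^*$ be its adjoint, and for $\hat g=\{g,T^*g\}$ put $$\Upsilon_0\hat g=\tfrac1{\sqrt2}(-\operatorname{Im}D)^{-1/2}\bigl(g(0+)-g(0-)\bigr),\qquad \Upsilon_1\hat g=\tfrac{i}{\sqrt2}(-\operatorname{Im}D)^{1/2}\bigl(g(0+)+g(0-)\bigr),$$ where $g(0\pm)$ are the limits at $0$ of the continuous representatives of $g$ on $(0,\infty)$ and $(-\infty,0)$. Then the relation in $\mathfrak H\oplus L^2(\mathbb R,\mathbb C^n)$ $$L=\left\{\left\{\binom fg,\binom{f'}{T^*g}\right\}:\ \hat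 f=\{f,f'\}\in S^*,\ \hat g=\{g,T^*g\},\ \Gamma_0\hat f=\Upsilon_0\hat g,\ (\Gamma_1-\operatorname{Re}D\,\Gamma_0)\hat f=-\Upsilon_1\hat g\right\}$$ is (the graph of) a selfadjoint operator, and it is a minimal selfadjoint dilation of $B$: for all $\lambda\in\mathbb C_+$ one has $\lambda\in\rho(L)\cap\rho(B)$ and $$P_{\mathfrak H}(L-\lambda)^{-1}\upharpoonright_{\mathfrak H}=(B-\lambda)^{-1},$$ and $\mathfrak H\oplus L^2(\mathbb R,\mathbb C^n)$ is the closed linear span of $\{(L-\lambda)^{-1}\mathfrak H:\lambda\in\mathbb C\setminus\mathbb R\}$. -/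

import Mathlib

open MeasureTheory Filter Topology
open scoped ComplexStarModule

noncomputable section

namespace LinRel

variable {H : Type*} [NormedAddCommGroup H] [InnerProductSpace ℂ H]

/-- A linear relation `T` in `H` (a subspace of `H × H`) is dissipative if `Im (f', f) ≤ 0` for all
`{f, f'} ∈ T`. Mathlib's inner product is linear in the second slot, so `(f', f)` is
`inner ℂ f f'`. -/
def IsDissipative (T : Submodule ℂ (H × H)) : Prop :=
  ∀ p ∈ T, (inner ℂ p.1 p.2).im ≤ 0

/-- A dissipative relation without proper dissipative extensions (among linear relations) in `H`. -/
def IsMaximalDissipative (T : Submodule ℂ (H × H)) : Prop :=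
  IsDissipative T ∧ ∀ T' : Submodule ℂ (H × H), T ≤ T' → IsDissipative T' → T' = T

/-- The inverse `(T - z)⁻¹ = {{f' - z f, f} : {f, f'} ∈ T}` as a linear relation. -/
def inverseShift (T : Submodule ℂ (H × H)) (z : ℂ) : Submodule ℂ (H × H) :=
  T.map ((LinearMap.snd ℂ H H - z • LinearMap.fst ℂ H H).prod (LinearMap.fst ℂ H H))

/-- `z` belongs to the resolvent set of `T`, and the bounded everywhere defined operator `R` is the
resolvent `(T - z)⁻¹`. -/
def IsResolventAt (T : Submodule ℂ (H × H)) (z : ℂ) (R : H →L[ℂ] H) : Prop :=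
  inverseShift T z = (R : H →ₗ[ℂ] H).graph

end LinRel

/-- A boundary triplet `{G, Γ₀, Γ₁}` for the adjoint relation `S*` of a linear relation `S`. -/
structure BoundaryTriplet {H : Type*} [NormedAddCommGroup H] [InnerProductSpace ℂ H]
    (S : Submodule ℂ (H × H)) (G : Type*) [NormedAddCommGroup G] [InnerProductSpace ℂ G] where
  Γ₀ : S.adjoint →ₗ[ℂ] G
  Γ₁ : S.adjoint →ₗ[ℂ] G
  green : ∀ f g : S.adjoint,
    inner ℂ g.1.1 f.1.2 - inner ℂ g.1.2 f.1.1
      = inner ℂ (Γ₀ g) (Γ₁ f) - inner ℂ (Γ₁ g) (Γ₀ f)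
  surjective : Function.Surjective (Γ₀.prod Γ₁)

/-- A minimal selfadjoint dilation `L`, acting in the Hilbert space `H ⊕ K`, of an operator `B`
in `H`. -/
def IsMinimalSelfadjointDilation {H K : Type*}
    [NormedAddCommGroup H] [InnerProductSpace ℂ H] [CompleteSpace H]
    [NormedAddCommGroup K] [InnerProductSpace ℂ K] [CompleteSpace K]
    (L : WithLp 2 (H × K) →ₗ.[ℂ] WithLp 2 (H × K)) (B : H →ₗ.[ℂ] H) : Prop :=
  IsSelfAdjoint L ∧
  (∀ z : ℂ, 0 < z.im →
    ∃ (R : WithLp 2 (H × K) →L[ℂ] WithLp 2 (H × K)) (Q : H →L[ℂ] H),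
      LinRel.IsResolventAt L.graph z R ∧ LinRel.IsResolventAt B.graph z Q ∧
      ∀ h : H, (R (WithLp.toLp 2 (h, 0))).fst = Q h) ∧
  (Submodule.span ℂ {u : WithLp 2 (H × K) |
    ∃ (z : ℂ) (R : WithLp 2 (H × K) →L[ℂ] WithLp 2 (H × K)) (h : H),
      z.im ≠ 0 ∧ LinRel.IsResolventAt L.graph z R ∧
      u = R (WithLp.toLp 2 (h, 0))}).topologicalClosure = ⊤

namespace FirstOrder

/-- The Hilbert space `ℂⁿ`. -/
abbrev Cn (n : ℕ) := EuclideanSpace ℂ (Fin n)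

/-- The Hilbert space `L²(ℝ, ℂⁿ)`. -/
abbrev L2 (n : ℕ) := Lp (Cn n) 2 (volume : Measure ℝ)

variable {n : ℕ}

theorem intervalIntegrable_L2 (w : L2 n) (x y : ℝ) : IntervalIntegrable w volume x y :=
  intervalIntegrable_iff.2 <| (((Lp.memLp w).locallyIntegrable (by norm_num)).integrableOn_isCompact
    isCompact_uIcc).mono_set Set.uIoc_subset_uIcc

/-- The function `φ` is the locally absolutely continuous representative of `g ∈ W¹₂(ℝ, ℂⁿ)`, whose
derivative is `w ∈ L²(ℝ, ℂⁿ)`. -/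
def IsSobolevRep (φ : ℝ → Cn n) (g w : L2 n) : Prop :=
  φ =ᵐ[volume] g ∧ ∀ x y : ℝ, φ y - φ x = ∫ t in x..y, w t

/-- The graph of the operator `T g = -i g'` with domain `{g ∈ W¹₂(ℝ, ℂⁿ) : g(0) = 0}`
in `L²(ℝ, ℂⁿ)`. -/
def T (n : ℕ) : Submodule ℂ (L2 n × L2 n) where
  carrier := {p | ∃ (φ : ℝ → Cn n) (w : L2 n),
    IsSobolevRep φ p.1 w ∧ φ 0 = 0 ∧ p.2 = (-Complex.I) • w}
  zero_mem' := by
    refine ⟨0, 0, ⟨(Lp.coeFn_zero _ _ _).symm, fun x y => ?_⟩, rfl, by simp⟩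
    have h : ∀ᵐ t ∂volume, t ∈ Set.uIoc x y → ((0 : L2 n) : ℝ → Cn n) t = (fun _ => 0) t := by
      filter_upwards [Lp.coeFn_zero (Cn n) 2 (volume : Measure ℝ)] with t ht _
      exact ht
    rw [intervalIntegral.integral_congr_ae h]
    simp
  add_mem' := by
    rintro p q ⟨φ, w, ⟨h1, h2⟩, h3, h4⟩ ⟨ψ, v, ⟨k1, k2⟩, k3, k4⟩
    refine ⟨φ + ψ, w + v, ⟨(h1.add k1).trans (Lp.coeFn_add _ _).symm, fun x y => ?_⟩,
      by simp [h3, k3], by simp [h4, k4]⟩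
    have h : ∀ᵐ t ∂volume, t ∈ Set.uIoc x y →
        ((w + v : L2 n) : ℝ → Cn n) t = w t + v t := by
      filter_upwards [Lp.coeFn_add w v] with t ht _
      simpa using ht
    rw [intervalIntegral.integral_congr_ae h, intervalIntegral.integral_add
      (intervalIntegrable_L2 w x y) (intervalIntegrable_L2 v x y), ← h2, ← k2]
    simp only [Pi.add_apply]
    abel
  smul_mem' := by
    rintro c p ⟨φ, w, ⟨h1, h2⟩, h3, h4⟩
    refine ⟨c • φ, c • w, ⟨(h1.const_smul c).trans (Lp.coeFn_smul _ _).symm, fun x y => ?_⟩,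
      by simp [h3], by simp [h4, smul_comm c]⟩
    have h : ∀ᵐ t ∂volume, t ∈ Set.uIoc x y →
        ((c • w : L2 n) : ℝ → Cn n) t = c • w t := by
      filter_upwards [Lp.coeFn_smul c w] with t ht _
      simpa using ht
    rw [intervalIntegral.integral_congr_ae h, intervalIntegral.integral_smul, ← h2]
    simp only [Pi.smul_apply, smul_sub]

/-- `a` is the boundary value at `0` of `g` from within the half line `J` (`J = (0, ∞)` gives
`a = g(0+)`, `J = (-∞, 0)` gives `a = g(0-)`): the limit at `0` of the continuous representative
of `g` on `J`. -/
def IsBoundaryValue (J : Set ℝ) (g : L2 n) (a : Cn n) : Prop :=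
  ∃ φ : ℝ → Cn n, φ =ᵐ[volume.restrict J] g ∧ ContinuousOn φ J ∧ Tendsto φ (𝓝[J] 0) (𝓝 a)

theorem IsBoundaryValue.zero (J : Set ℝ) : IsBoundaryValue J (0 : L2 n) 0 :=
  ⟨0, ae_restrict_of_ae (Lp.coeFn_zero _ _ _).symm, continuousOn_const, tendsto_const_nhds⟩

theorem IsBoundaryValue.add {J : Set ℝ} {g h : L2 n} {a b : Cn n}
    (hg : IsBoundaryValue J g a) (hh : IsBoundaryValue J h b) :
    IsBoundaryValue J (g + h) (a + b) := by
  obtain ⟨φ, h1, h2, h3⟩ := hg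
  obtain ⟨ψ, k1, k2, k3⟩ := hh
  exact ⟨φ + ψ, (h1.add k1).trans (ae_restrict_of_ae (Lp.coeFn_add _ _).symm), h2.add k2, h3.add k3⟩

theorem IsBoundaryValue.smul {J : Set ℝ} {g : L2 n} {a : Cn n} (c : ℂ)
    (hg : IsBoundaryValue J g a) : IsBoundaryValue J (c • g) (c • a) := by
  obtain ⟨φ, h1, h2, h3⟩ := hg
  exact ⟨c • φ, (h1.const_smul c).trans (ae_restrict_of_ae (Lp.coeFn_smul _ _).symm),
    h2.const_smul c, h3.const_smul c⟩

open scoped MatrixOrder in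
/-- The matrix `(-Im D)^{1/2}`. -/
def sqrtNegIm (D : Matrix (Fin n) (Fin n) ℂ) : Matrix (Fin n) (Fin n) ℂ :=
  CFC.sqrt (-(ℑ D : Matrix (Fin n) (Fin n) ℂ))

/-- `Υ₀ ĝ = 2^{-1/2} (-Im D)^{-1/2} (a - b)` for `a = g(0+)` and `b = g(0-)`. -/
def upsilon₀ (D : Matrix (Fin n) (Fin n) ℂ) (a b : Cn n) : Cn n :=
  (1 / (Real.sqrt 2 : ℂ)) • Matrix.toEuclideanLin (sqrtNegIm D)⁻¹ (a - b)

/-- `Υ₁ ĝ = i 2^{-1/2} (-Im D)^{1/2} (a + b)` for `a = g(0+)` and `b = g(0-)`. -/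
def upsilon₁ (D : Matrix (Fin n) (Fin n) ℂ) (a b : Cn n) : Cn n :=
  (Complex.I / (Real.sqrt 2 : ℂ)) • Matrix.toEuclideanLin (sqrtNegIm D) (a + b)

end FirstOrder

open FirstOrder in
/-- The relation `L` in `H ⊕ L²(ℝ, ℂⁿ)`: all pairs `{(f, g), (f', g')}` with `f̂ = {f, f'} ∈ S*`,
`ĝ = {g, g'} ∈ T*`, `Γ₀ f̂ = Υ₀ ĝ` and `(Γ₁ - Re D Γ₀) f̂ = -Υ₁ ĝ`. -/
def couplingRelation {H : Type*} [NormedAddCommGroup H] [InnerProductSpace ℂ H] {n : ℕ}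
    {S : Submodule ℂ (H × H)} (Pi : BoundaryTriplet S (Cn n)) (D : Matrix (Fin n) (Fin n) ℂ) :
    Submodule ℂ (WithLp 2 (H × L2 n) × WithLp 2 (H × L2 n)) where
  carrier := {p | ∃ (hf : (p.1.fst, p.2.fst) ∈ S.adjoint) (a b : Cn n),
    (p.1.snd, p.2.snd) ∈ (T n).adjoint ∧
    IsBoundaryValue (Set.Ioi 0) p.1.snd a ∧ IsBoundaryValue (Set.Iio 0) p.1.snd b ∧
    Pi.Γ₀ ⟨_, hf⟩ = upsilon₀ D a b ∧
    Pi.Γ₁ ⟨_, hf⟩ - Matrix.toEuclideanLin (ℜ D : Matrix (Fin n) (Fin n) ℂ) (Pi.Γ₀ ⟨_, hf⟩)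
      = -upsilon₁ D a b}
  zero_mem' := by
    refine ⟨S.adjoint.zero_mem, 0, 0, (T n).adjoint.zero_mem, .zero _, .zero _, ?_, ?_⟩
    · exact (map_zero Pi.Γ₀).trans (by simp [upsilon₀])
    · have h0 : Pi.Γ₀ ⟨0, S.adjoint.zero_mem⟩ = 0 := map_zero Pi.Γ₀
      have h1 : Pi.Γ₁ ⟨0, S.adjoint.zero_mem⟩ = 0 := map_zero Pi.Γ₁
      refine (congrArg₂ (fun u v => u - Matrix.toEuclideanLin
        (ℜ D : Matrix (Fin n) (Fin n) ℂ) v) h1 h0).trans ?_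
      simp [upsilon₁]
  add_mem' := by
    rintro p q ⟨hf, a, b, h1, h2, h3, h4, h5⟩ ⟨kf, a', b', k1, k2, k3, k4, k5⟩
    have e0 : Pi.Γ₀ ⟨_, S.adjoint.add_mem hf kf⟩ = Pi.Γ₀ ⟨_, hf⟩ + Pi.Γ₀ ⟨_, kf⟩ :=
      map_add Pi.Γ₀ ⟨_, hf⟩ ⟨_, kf⟩
    have e1 : Pi.Γ₁ ⟨_, S.adjoint.add_mem hf kf⟩ = Pi.Γ₁ ⟨_, hf⟩ + Pi.Γ₁ ⟨_, kf⟩ :=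
      map_add Pi.Γ₁ ⟨_, hf⟩ ⟨_, kf⟩
    refine ⟨S.adjoint.add_mem hf kf, a + a', b + b', (T n).adjoint.add_mem h1 k1, h2.add k2,
      h3.add k3, ?_, ?_⟩
    · refine e0.trans ?_
      rw [h4, k4]
      simp only [upsilon₀, map_sub, map_add, smul_add, smul_sub]
      abel
    · refine (congrArg₂ (fun u v => u - Matrix.toEuclideanLin
        (ℜ D : Matrix (Fin n) (Fin n) ℂ) v) e1 e0).trans ?_
      have : -upsilon₁ D (a + a') (b + b') = -upsilon₁ D a b + -upsilon₁ D a' b' := by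
        simp only [upsilon₁, map_add, smul_add]
        abel
      rw [this, ← h5, ← k5]
      simp only [map_add]
      abel
  smul_mem' := by
    rintro c p ⟨hf, a, b, h1, h2, h3, h4, h5⟩
    have e0 : Pi.Γ₀ ⟨_, S.adjoint.smul_mem c hf⟩ = c • Pi.Γ₀ ⟨_, hf⟩ :=
      map_smul Pi.Γ₀ c ⟨_, hf⟩
    have e1 : Pi.Γ₁ ⟨_, S.adjoint.smul_mem c hf⟩ = c • Pi.Γ₁ ⟨_, hf⟩ :=
      map_smul Pi.Γ₁ c ⟨_, hf⟩
    refine ⟨S.adjoint.smul_mem c hf, c • a, c • b, (T n).adjoint.smul_mem c h1, h2.smul c,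
      h3.smul c, ?_, ?_⟩
    · refine e0.trans ?_
      rw [h4]
      simp only [upsilon₀, ← smul_sub, map_smul]
      rw [smul_comm]
    · refine (congrArg₂ (fun u v => u - Matrix.toEuclideanLin
        (ℜ D : Matrix (Fin n) (Fin n) ℂ) v) e1 e0).trans ?_
      have : -upsilon₁ D (c • a) (c • b) = c • -upsilon₁ D a b := by
        simp only [upsilon₁, ← smul_add, map_smul, smul_neg]
        rw [smul_comm]
      rw [this, ← h5]
      simp only [map_smul, smul_sub]

end

/-!
The dilation is a coupling: `L` glues `S*` to the first order operator `T*` along boundary values.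
Green's identity and the surjectivity of the boundary maps make any such coupling selfadjoint.

For `Im z > 0` the square integrable solutions of `-i g' = z g` vanish on the left half line, so
`Υ₁ ĝ = -i (Im D) Υ₀ ĝ` for every `ĝ = {g, z g} ∈ T*`. The Weyl function of the triplet `Υ` is thus
constant on the upper half plane, and the interface conditions of `L` turn into
`Γ₁ f̂ = (Re D + i Im D) Γ₀ f̂ = D Γ₀ f̂` for the first component of `(L - z)⁻¹ (h, 0)`, which
says that this component is `(B - z)⁻¹ h`.

Minimality comes down to the simplicity of `T`: the defect elements of `T` are exponentials on the
two half lines, and these span a dense subspace since the Fourier transform is injective.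
-/

open scoped InnerProductSpace

/-! ### Resolvents of linear relations -/

namespace LinRel

variable {H : Type*} [NormedAddCommGroup H] [InnerProductSpace ℂ H] {L : Submodule ℂ (H × H)}
  {z : ℂ}

theorem mem_inverseShift {x y : H} : (x, y) ∈ inverseShift L z ↔ (y, x + z • y) ∈ L := by
  constructor
  · rintro ⟨⟨f, f'⟩, hf, h⟩
    obtain ⟨rfl, rfl⟩ := Prod.ext_iff.1 h
    simpa using hf
  · exact fun h => ⟨(y, x + z • y), h, by simp⟩

theorem isResolventAt_iff {R : H →L[ℂ] H} :
    IsResolventAt L z R ↔ ∀ x y, (y, x + z • y) ∈ L ↔ y = R x := by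
  rw [IsResolventAt, Submodule.ext_iff]
  simp only [Prod.forall, mem_inverseShift, LinearMap.mem_graph_iff, ContinuousLinearMap.coe_coe]

theorem IsResolventAt.mem {R : H →L[ℂ] H} (hR : IsResolventAt L z R) (x : H) :
    (R x, x + z • R x) ∈ L :=
  (isResolventAt_iff.1 hR _ _).2 rfl

section NumericalRange

theorem im_inner_sub_smul (p : H × H) (z : ℂ) :
    (⟪p.1, p.2 - z • p.1⟫_ℂ).im = (⟪p.1, p.2⟫_ℂ).im - z.im * ‖p.1‖ ^ 2 := by
  have hself : ⟪p.1, p.1⟫_ℂ = ((‖p.1‖ ^ 2 : ℝ) : ℂ) := by simp [inner_self_eq_norm_sq_to_K]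
  rw [inner_sub_right, inner_smul_right, hself, Complex.sub_im, Complex.im_mul_ofReal]

theorem abs_im_inner_sub_le (p : H × H) (z : ℂ) :
    |(⟪p.1, p.2⟫_ℂ).im - z.im * ‖p.1‖ ^ 2| ≤ ‖p.1‖ * ‖p.2 - z • p.1‖ := by
  rw [← im_inner_sub_smul]
  exact (Complex.abs_im_le_norm _).trans (norm_inner_le_norm _ _)

theorem IsDissipative.im_mul_norm_le (hL : IsDissipative L) {p : H × H} (hp : p ∈ L) (z : ℂ) :
    z.im * ‖p.1‖ ≤ ‖p.2 - z • p.1‖ := by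
  rcases (norm_nonneg p.1).eq_or_lt with h0 | h0
  · simp [← h0]
  · refine le_of_mul_le_mul_left ?_ h0
    linarith [neg_le_of_abs_le (abs_im_inner_sub_le p z), hL p hp]

theorem im_inner_eq_zero_of_le_adjoint (hL : L ≤ L.adjoint) {p : H × H} (hp : p ∈ L) :
    (⟪p.1, p.2⟫_ℂ).im = 0 := by
  have h := (Submodule.mem_adjoint_iff _ _).1 (hL hp) p.1 p.2 hp
  rw [← inner_conj_symm p.2 p.1, sub_eq_zero] at h
  exact Complex.conj_eq_iff_im.1 h

theorem abs_im_mul_norm_le (hL : L ≤ L.adjoint) {p : H × H} (hp : p ∈ L) (z : ℂ) :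
    |z.im| * ‖p.1‖ ≤ ‖p.2 - z • p.1‖ := by
  rcases (norm_nonneg p.1).eq_or_lt with h0 | h0
  · simp [← h0]
  · refine le_of_mul_le_mul_left ?_ h0
    have h := abs_im_inner_sub_le p z
    rw [im_inner_eq_zero_of_le_adjoint hL hp, zero_sub, abs_neg, abs_mul,
      abs_of_nonneg (sq_nonneg ‖p.1‖)] at h
    linarith

theorem IsDissipative.isResolventAt (hL : IsDissipative L) (hz : 0 < z.im) {R : H →L[ℂ] H}
    (hR : ∀ x, (R x, x + z • R x) ∈ L) : IsResolventAt L z R := by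
  refine isResolventAt_iff.2 fun x y => ⟨fun h => ?_, fun h => h ▸ hR x⟩
  have hsub : (y - R x, z • (y - R x)) ∈ L := by
    convert L.sub_mem h (hR x) using 1
    simp [smul_sub]
  have hle := hL.im_mul_norm_le hsub z
  rw [sub_self, norm_zero] at hle
  exact sub_eq_zero.1 (norm_le_zero_iff.1 (nonpos_of_mul_nonpos_right hle hz))

end NumericalRange

section SelfAdjoint

theorem mem_adjoint_of_forall {p : H × H}
    (h : ∀ q ∈ L, ⟪q.2, p.1⟫_ℂ = ⟪q.1, p.2⟫_ℂ) : p ∈ L.adjoint :=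
  (Submodule.mem_adjoint_iff _ _).2 fun a b hab => sub_eq_zero.2 (h (a, b) hab)

theorem inner_eq_of_mem_adjoint {p q : H × H} (hp : p ∈ L.adjoint) (hq : q ∈ L) :
    ⟪q.2, p.1⟫_ℂ = ⟪q.1, p.2⟫_ℂ :=
  sub_eq_zero.1 ((Submodule.mem_adjoint_iff _ _).1 hp q.1 q.2 hq)

theorem IsResolventAt.inner_right (hL : L ≤ L.adjoint) {R R' : H →L[ℂ] H}
    (hR : IsResolventAt L z R) (hR' : IsResolventAt L ((starRingEnd ℂ) z) R') (x y : H) :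
    ⟪x, R y⟫_ℂ = ⟪R' x, y⟫_ℂ := by
  have h := inner_eq_of_mem_adjoint (hL (hR.mem y)) (hR'.mem x)
  simp only [inner_add_left, inner_add_right, inner_smul_left, inner_smul_right,
    Complex.conj_conj] at h
  exact add_right_cancel h

theorem isClosed_adjoint (L : Submodule ℂ (H × H)) : IsClosed (L.adjoint : Set (H × H)) := by
  have : (L.adjoint : Set (H × H)) = ⋂ q ∈ L, {p | ⟪q.2, p.1⟫_ℂ = ⟪q.1, p.2⟫_ℂ} := by
    ext p
    simp only [Set.mem_iInter]
    exact ⟨fun hp q hq => inner_eq_of_mem_adjoint hp hq, mem_adjoint_of_forall⟩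
  rw [this]
  exact isClosed_biInter fun q _ => isClosed_eq (by fun_prop) (by fun_prop)

/-- The bounded operator `{f, f'} ↦ f' - z f` on a linear relation, whose range is that of
`L - z`. -/
noncomputable def shift (L : Submodule ℂ (H × H)) (z : ℂ) : L →L[ℂ] H :=
  (ContinuousLinearMap.snd ℂ H H - z • ContinuousLinearMap.fst ℂ H H).comp L.subtypeL

theorem shift_apply (p : L) : shift L z p = p.1.2 - z • p.1.1 := rfl

theorem antilipschitz_shift (hL : L ≤ L.adjoint) (hz : z.im ≠ 0) :
    ∃ C, AntilipschitzWith C (shift L z) := by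
  have hzpos : 0 < |z.im| := abs_pos.2 hz
  refine ⟨⟨1 + (1 + ‖z‖) * |z.im|⁻¹, by positivity⟩,
    (shift L z).antilipschitz_of_bound fun p => ?_⟩
  have hfst : ‖p.1.1‖ ≤ |z.im|⁻¹ * ‖shift L z p‖ := by
    rw [le_inv_mul_iff₀ hzpos]
    exact abs_im_mul_norm_le hL p.2 z
  have hsnd : ‖p.1.2‖ ≤ ‖shift L z p‖ + ‖z‖ * ‖p.1.1‖ := by
    rw [← norm_smul, shift_apply]
    exact norm_le_norm_sub_add _ _
  calc ‖p.1‖ ≤ ‖p.1.1‖ + ‖p.1.2‖ := max_le_add_of_nonneg (norm_nonneg _) (norm_nonneg _)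
    _ ≤ ‖shift L z p‖ + (1 + ‖z‖) * ‖p.1.1‖ := by linarith
    _ ≤ ‖shift L z p‖ + (1 + ‖z‖) * (|z.im|⁻¹ * ‖shift L z p‖) := by gcongr
    _ = (1 + (1 + ‖z‖) * |z.im|⁻¹) * ‖shift L z p‖ := by ring

theorem mem_adjoint_of_mem_orthogonal_range {u : H} (hu : u ∈ (shift L z).rangeᗮ) :
    (u, (starRingEnd ℂ) z • u) ∈ L.adjoint := by
  refine mem_adjoint_of_forall fun q hq => ?_
  have h := (Submodule.mem_orthogonal _ _).1 hu _ ⟨⟨q, hq⟩, rfl⟩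
  simp only [ContinuousLinearMap.coe_coe, shift_apply, inner_sub_left, inner_smul_left,
    sub_eq_zero] at h
  rw [h, inner_smul_right]

variable [CompleteSpace H]

theorem range_shift_eq_top (hL : L.adjoint = L) (hz : z.im ≠ 0) : (shift L z).range = ⊤ := by
  have : CompleteSpace L := (hL ▸ isClosed_adjoint L).completeSpace_coe
  obtain ⟨C, hC⟩ := antilipschitz_shift hL.ge hz
  have hclosed : IsClosed ((shift L z).range : Set H) :=
    hC.isClosed_range (shift L z).uniformContinuous
  rw [← hclosed.submodule_topologicalClosure_eq, Submodule.topologicalClosure_eq_top_iff,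
    Submodule.eq_bot_iff]
  intro u hu
  have hle := abs_im_mul_norm_le hL.ge (hL ▸ mem_adjoint_of_mem_orthogonal_range hu)
    ((starRingEnd ℂ) z)
  rw [sub_self, norm_zero, Complex.conj_im, abs_neg] at hle
  exact norm_le_zero_iff.1 (nonpos_of_mul_nonpos_right hle (abs_pos.2 hz))

theorem exists_isResolventAt (hL : L.adjoint = L) (hz : z.im ≠ 0) :
    ∃ R : H →L[ℂ] H, IsResolventAt L z R := by
  have : CompleteSpace L := (hL ▸ isClosed_adjoint L).completeSpace_coe
  obtain ⟨C, hC⟩ := antilipschitz_shift hL.ge hz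
  let e := ContinuousLinearEquiv.ofBijective (shift L z)
    (LinearMap.ker_eq_bot.2 hC.injective) (range_shift_eq_top hL hz)
  have he (p : L) : e p = p.1.2 - z • p.1.1 := rfl
  refine ⟨(ContinuousLinearMap.fst ℂ H H).comp (L.subtypeL.comp (e.symm : H →L[ℂ] L)),
    isResolventAt_iff.2 fun x y => ?_⟩
  change _ ↔ y = (e.symm x).1.1
  constructor
  · intro h
    rw [(ContinuousLinearEquiv.symm_apply_eq e).2 (_ : x = e ⟨_, h⟩)]
    simp [he]
  · rintro rfl
    convert (e.symm x).2
    rw [← eq_sub_iff_add_eq, ← he, e.apply_symm_apply]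

theorem dense_domain_of_graph_adjoint_eq {L : H →ₗ.[ℂ] H} (hL : L.graph.adjoint = L.graph) :
    Dense (L.domain : Set H) := by
  rw [Submodule.dense_iff_topologicalClosure_eq_top, Submodule.topologicalClosure_eq_top_iff,
    Submodule.eq_bot_iff]
  intro u hu
  have h : ((0 : H), u) ∈ L.graph := hL ▸ mem_adjoint_of_forall fun q hq => by
    rw [inner_zero_right, (Submodule.mem_orthogonal _ _).1 hu q.1
      (LinearPMap.mem_domain_of_mem_graph hq)]
  exact L.graph_fst_eq_zero_snd h rfl

theorem isSelfAdjoint_of_graph_adjoint_eq {L : H →ₗ.[ℂ] H} (hL : L.graph.adjoint = L.graph) :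
    IsSelfAdjoint L := by
  rw [LinearPMap.isSelfAdjoint_def]
  apply LinearPMap.eq_of_eq_graph
  rw [LinearPMap.adjoint_graph_eq_graph_adjoint (dense_domain_of_graph_adjoint_eq hL), hL]

end SelfAdjoint

section WeakLimit

open Complex (I)

variable {x : H} {R : ℝ → H}

theorem mul_norm_resolvent_le (hL : L ≤ L.adjoint)
    (hR : ∀ t > 0, (R t, x + (t * I : ℂ) • R t) ∈ L) {t : ℝ} (ht : 0 < t) :
    t * ‖R t‖ ≤ ‖x‖ := by
  simpa [abs_of_pos ht] using abs_im_mul_norm_le hL (hR t ht) (t * I)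

theorem norm_add_smul_resolvent_le (hL : L ≤ L.adjoint)
    (hR : ∀ t > 0, (R t, x + (t * I : ℂ) • R t) ∈ L) {t : ℝ} (ht : 0 < t) :
    ‖x + (t * I : ℂ) • R t‖ ≤ 2 * ‖x‖ := by
  refine (norm_add_le _ _).trans ?_
  have hnorm : ‖(t * I : ℂ) • R t‖ = t * ‖R t‖ := by
    simp [norm_smul, abs_of_pos ht]
  linarith [mul_norm_resolvent_le hL hR ht]

-- For `{u, u'} ∈ L` symmetry turns the inner product into `⟪u', R t⟫ = O(1/t)`; the general case
-- follows by density since `x + i t R t` stays bounded.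
theorem tendsto_inner_add_smul_resolvent {L : H →ₗ.[ℂ] H} (hL : L.graph ≤ L.graph.adjoint)
    (hd : Dense (L.domain : Set H)) (hR : ∀ t > 0, (R t, x + (t * I : ℂ) • R t) ∈ L.graph)
    (u : H) : Tendsto (fun t : ℝ => ⟪u, x + (t * I : ℂ) • R t⟫_ℂ) atTop (𝓝 0) := by
  have hdom : ∀ v : L.domain,
      Tendsto (fun t : ℝ => ⟪(v : H), x + (t * I : ℂ) • R t⟫_ℂ) atTop (𝓝 0) := fun v => by
    refine squeeze_zero_norm' (a := fun t => ‖L v‖ * ‖x‖ * t⁻¹) ?_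
      (by simpa using tendsto_inv_atTop_zero.const_mul (‖L v‖ * ‖x‖))
    filter_upwards [eventually_gt_atTop 0] with t ht
    rw [← inner_eq_of_mem_adjoint (hL (hR t ht)) (L.mem_graph v), mul_assoc]
    refine (norm_inner_le_norm _ _).trans (mul_le_mul_of_nonneg_left ?_ (norm_nonneg _))
    rw [← div_eq_mul_inv, le_div_iff₀' ht]
    exact mul_norm_resolvent_le hL hR ht
  rw [Metric.tendsto_nhds]
  intro ε hε
  obtain ⟨v, hv, huv⟩ := hd.exists_dist_lt u (ε := ε / (2 * (2 * ‖x‖ + 1))) (by positivity)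
  rw [dist_eq_norm, lt_div_iff₀ (by positivity)] at huv
  filter_upwards [eventually_gt_atTop 0,
    Metric.tendsto_nhds.1 (hdom ⟨v, hv⟩) (ε / 2) (by positivity)] with t ht hvt
  rw [dist_zero_right] at hvt ⊢
  have hdiff : ‖⟪u - v, x + (t * I : ℂ) • R t⟫_ℂ‖ ≤ ‖u - v‖ * (2 * ‖x‖) :=
    (norm_inner_le_norm _ _).trans (by gcongr; exact norm_add_smul_resolvent_le hL hR ht)
  calc ‖⟪u, x + (t * I : ℂ) • R t⟫_ℂ‖
      = ‖⟪u - v, x + (t * I : ℂ) • R t⟫_ℂ + ⟪v, x + (t * I : ℂ) • R t⟫_ℂ‖ := by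
        rw [← inner_add_left, sub_add_cancel]
    _ ≤ ‖⟪u - v, x + (t * I : ℂ) • R t⟫_ℂ‖ + ‖⟪v, x + (t * I : ℂ) • R t⟫_ℂ‖ := norm_add_le _ _
    _ < ε := by nlinarith [norm_nonneg (u - v)]

theorem inner_eq_zero_of_inner_resolvent_eq_zero {L : H →ₗ.[ℂ] H}
    (hL : L.graph ≤ L.graph.adjoint) (hd : Dense (L.domain : Set H))
    (hR : ∀ t > 0, (R t, x + (t * I : ℂ) • R t) ∈ L.graph) {u : H}
    (hu : ∀ t > 0, ⟪u, R t⟫_ℂ = 0) : ⟪u, x⟫_ℂ = 0 := by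
  refine tendsto_nhds_unique (tendsto_const_nhds.congr' ?_)
    (tendsto_inner_add_smul_resolvent hL hd hR u)
  filter_upwards [eventually_gt_atTop 0] with t ht
  rw [inner_add_right, inner_smul_right, hu t ht, mul_zero, add_zero]

end WeakLimit

/-- A symmetric relation is simple (completely nonselfadjoint) if the defect elements of its adjoint
at the nonreal points span a dense subspace. -/
def IsSimple (S : Submodule ℂ (H × H)) : Prop :=
  ∀ v : H, (∀ (z : ℂ) (e : H), z.im ≠ 0 → (e, z • e) ∈ S.adjoint → ⟪e, v⟫_ℂ = 0) → v = 0

/-- The pair `{f, f'} ⊕ {g, g'} = {(f, g), (f', g')}` in `H ⊕ K`. -/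
noncomputable def directSum {K : Type*} [NormedAddCommGroup K] [InnerProductSpace ℂ K]
    (S : Submodule ℂ (H × H)) (T : Submodule ℂ (K × K)) :
    S × T →ₗ[ℂ] WithLp 2 (H × K) × WithLp 2 (H × K) :=
  ((LinearEquiv.prodProdProdComm ℂ H H K K).trans
    ((WithLp.linearEquiv 2 ℂ (H × K)).symm.prodCongr (WithLp.linearEquiv 2 ℂ (H × K)).symm)) ∘ₗ
    S.subtype.prodMap T.subtype

end LinRel

/-! ### Boundary triplets and couplings -/

namespace BoundaryTriplet

variable {H K G : Type*} [NormedAddCommGroup H] [InnerProductSpace ℂ H]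
  [NormedAddCommGroup K] [InnerProductSpace ℂ K] [NormedAddCommGroup G] [InnerProductSpace ℂ G]
  {S : Submodule ℂ (H × H)} {T : Submodule ℂ (K × K)}

theorem Γ_eq_zero_of_mem (Pi : BoundaryTriplet S G) {p : S.adjoint} (hp : p.1 ∈ S) :
    Pi.Γ₀ p = 0 ∧ Pi.Γ₁ p = 0 := by
  have hΓ : ∀ f, ⟪Pi.Γ₀ p, Pi.Γ₁ f⟫_ℂ = ⟪Pi.Γ₁ p, Pi.Γ₀ f⟫_ℂ := fun f => by
    rw [← sub_eq_zero, ← Pi.green, LinRel.inner_eq_of_mem_adjoint f.2 hp, sub_self]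
  obtain ⟨f, hf⟩ := Pi.surjective (0, Pi.Γ₀ p)
  obtain ⟨g, hg⟩ := Pi.surjective (Pi.Γ₁ p, 0)
  obtain ⟨hf₀ : Pi.Γ₀ f = 0, hf₁ : Pi.Γ₁ f = Pi.Γ₀ p⟩ := Prod.ext_iff.1 hf
  obtain ⟨hg₀ : Pi.Γ₀ g = Pi.Γ₁ p, hg₁ : Pi.Γ₁ g = 0⟩ := Prod.ext_iff.1 hg
  constructor
  · simpa [hf₀, hf₁] using hΓ f
  · simpa [hg₀, hg₁] using (hΓ g).symm

section Extension

/-- The extension `ker (Γ₁ - D Γ₀)` of `S` determined by the operator `D` in the boundary space. -/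
noncomputable def extension (Pi : BoundaryTriplet S G) (D : G →ₗ[ℂ] G) : Submodule ℂ (H × H) :=
  (LinearMap.ker (Pi.Γ₁ - D ∘ₗ Pi.Γ₀)).map S.adjoint.subtype

variable {Pi : BoundaryTriplet S G} {D : G →ₗ[ℂ] G}

theorem coe_mem_extension {f : S.adjoint} :
    (f : H × H) ∈ Pi.extension D ↔ Pi.Γ₁ f = D (Pi.Γ₀ f) := by
  simp [extension, sub_eq_zero]

theorem extension_le_adjoint : Pi.extension D ≤ S.adjoint :=
  Submodule.map_subtype_le _ _

theorem im_inner_eq (f : S.adjoint) :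
    (⟪f.1.1, f.1.2⟫_ℂ).im = (⟪Pi.Γ₀ f, Pi.Γ₁ f⟫_ℂ).im := by
  have h := congrArg Complex.im (Pi.green f f)
  rw [← inner_conj_symm f.1.2, ← inner_conj_symm (Pi.Γ₁ f), Complex.sub_im, Complex.sub_im,
    Complex.conj_im, Complex.conj_im] at h
  linarith

theorem isDissipative_extension (hD : LinRel.IsDissipative D.graph) :
    LinRel.IsDissipative (Pi.extension D) := fun p hp => by
  lift p to S.adjoint using extension_le_adjoint hp
  rw [im_inner_eq (Pi := Pi), coe_mem_extension.1 hp]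
  exact hD (Pi.Γ₀ p, D (Pi.Γ₀ p)) rfl

end Extension

section Coupling

variable {Pi : BoundaryTriplet S G} {Up : BoundaryTriplet T G} {R M : G →ₗ[ℂ] G}

/-- The coupling of two boundary triplets by the interface conditions `Γ₀ f̂ = Υ₀ ĝ` and
`(Γ₁ - R Γ₀) f̂ = -Υ₁ ĝ`. -/
noncomputable def coupling (Pi : BoundaryTriplet S G) (Up : BoundaryTriplet T G) (R : G →ₗ[ℂ] G) :
    Submodule ℂ (WithLp 2 (H × K) × WithLp 2 (H × K)) :=
  (LinearMap.ker ((Pi.Γ₀.coprod (-Up.Γ₀)).prod ((Pi.Γ₁ - R ∘ₗ Pi.Γ₀).coprod Up.Γ₁))).map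
    (LinRel.directSum S.adjoint T.adjoint)

theorem mem_coupling_iff {p : WithLp 2 (H × K) × WithLp 2 (H × K)} :
    p ∈ Pi.coupling Up R ↔ ∃ (f : S.adjoint) (g : T.adjoint),
      Pi.Γ₀ f = Up.Γ₀ g ∧ Pi.Γ₁ f - R (Pi.Γ₀ f) = -Up.Γ₁ g ∧ LinRel.directSum _ _ (f, g) = p := by
  simp only [coupling, Submodule.mem_map, LinearMap.mem_ker, Prod.exists, LinearMap.prod_apply,
    Function.prod_apply, LinearMap.coprod_apply, Prod.mk_eq_zero, LinearMap.neg_apply,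
    ← sub_eq_add_neg, sub_eq_zero, LinearMap.sub_apply, LinearMap.comp_apply,
    add_eq_zero_iff_eq_neg, and_assoc]

theorem coupling_le_adjoint (hR : R.IsSymmetric) :
    Pi.coupling Up R ≤ (Pi.coupling Up R).adjoint := by
  intro p hp
  refine LinRel.mem_adjoint_of_forall fun q hq => ?_
  obtain ⟨f, g, h₀, h₁, rfl⟩ := mem_coupling_iff.1 hp
  obtain ⟨f', g', h₀', h₁', rfl⟩ := mem_coupling_iff.1 hq
  change ⟪f'.1.2, f.1.1⟫_ℂ + ⟪g'.1.2, g.1.1⟫_ℂ = ⟪f'.1.1, f.1.2⟫_ℂ + ⟪g'.1.1, g.1.2⟫_ℂ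
  have hPi := Pi.green f f'
  rw [sub_eq_iff_eq_add.1 h₁, sub_eq_iff_eq_add.1 h₁', h₀, h₀'] at hPi
  simp only [inner_add_left, inner_add_right, inner_neg_left, inner_neg_right, hR _ _] at hPi
  linear_combination -hPi - Up.green g g'

theorem adjoint_coupling_le (hS : S ≤ S.adjoint) (hT : T ≤ T.adjoint) (hR : R.IsSymmetric) :
    (Pi.coupling Up R).adjoint ≤ Pi.coupling Up R := by
  intro p hp
  have htest : ∀ (f : S.adjoint) (g : T.adjoint), Pi.Γ₀ f = Up.Γ₀ g →
      Pi.Γ₁ f - R (Pi.Γ₀ f) = -Up.Γ₁ g →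
      ⟪f.1.2, p.1.fst⟫_ℂ + ⟪g.1.2, p.1.snd⟫_ℂ = ⟪f.1.1, p.2.fst⟫_ℂ + ⟪g.1.1, p.2.snd⟫_ℂ :=
    fun f g h₀ h₁ => LinRel.inner_eq_of_mem_adjoint hp (mem_coupling_iff.2 ⟨f, g, h₀, h₁, rfl⟩)
  have hf : (p.1.fst, p.2.fst) ∈ S.adjoint := LinRel.mem_adjoint_of_forall fun q hq => by
    obtain ⟨h₀, h₁⟩ := Pi.Γ_eq_zero_of_mem (p := ⟨q, hS hq⟩) hq
    simpa using htest ⟨q, hS hq⟩ 0 (by simp [h₀]) (by simp [h₀, h₁])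
  have hg : (p.1.snd, p.2.snd) ∈ T.adjoint := LinRel.mem_adjoint_of_forall fun q hq => by
    obtain ⟨h₀, h₁⟩ := Up.Γ_eq_zero_of_mem (p := ⟨q, hT hq⟩) hq
    simpa using htest 0 ⟨q, hT hq⟩ (by simp [h₀]) (by simp [h₁])
  have hxy : ∀ x y : G, ⟪x, Pi.Γ₁ ⟨_, hf⟩ - R (Pi.Γ₀ ⟨_, hf⟩) + Up.Γ₁ ⟨_, hg⟩⟫_ℂ
      + ⟪y, Pi.Γ₀ ⟨_, hf⟩ - Up.Γ₀ ⟨_, hg⟩⟫_ℂ = 0 := fun x y => by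
    obtain ⟨f, hfxy⟩ := Pi.surjective (x, R x - y)
    obtain ⟨g, hgxy⟩ := Up.surjective (x, y)
    obtain ⟨hf₀ : Pi.Γ₀ f = x, hf₁ : Pi.Γ₁ f = R x - y⟩ := Prod.ext_iff.1 hfxy
    obtain ⟨hg₀ : Up.Γ₀ g = x, hg₁ : Up.Γ₁ g = y⟩ := Prod.ext_iff.1 hgxy
    have hPi := Pi.green ⟨_, hf⟩ f
    have hUp := Up.green ⟨_, hg⟩ g
    have hpq := htest f g (by rw [hf₀, hg₀]) (by rw [hf₁, hf₀, hg₁]; abel)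
    rw [hf₀, hf₁, inner_sub_left, hR] at hPi
    rw [hg₀, hg₁] at hUp
    simp only [inner_add_right, inner_sub_right]
    linear_combination -hPi - hUp - hpq
  refine mem_coupling_iff.2 ⟨⟨_, hf⟩, ⟨_, hg⟩, ?_, ?_, rfl⟩
  · rw [← sub_eq_zero, ← inner_self_eq_zero (𝕜 := ℂ)]
    simpa using hxy 0 (Pi.Γ₀ ⟨_, hf⟩ - Up.Γ₀ ⟨_, hg⟩)
  · rw [← add_eq_zero_iff_eq_neg, ← inner_self_eq_zero (𝕜 := ℂ)]
    simpa using hxy (Pi.Γ₁ ⟨_, hf⟩ - R (Pi.Γ₀ ⟨_, hf⟩) + Up.Γ₁ ⟨_, hg⟩) 0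

theorem adjoint_coupling (hS : S ≤ S.adjoint) (hT : T ≤ T.adjoint) (hR : R.IsSymmetric) :
    (Pi.coupling Up R).adjoint = Pi.coupling Up R :=
  (adjoint_coupling_le hS hT hR).antisymm (coupling_le_adjoint hR)

theorem eq_zero_of_zero_mem_coupling {D : G →ₗ[ℂ] G}
    (hD : ∀ f' : H, (0, f') ∈ Pi.extension D → f' = 0)
    (hT : ∀ g' : K, (0, g') ∈ T.adjoint → g' = 0)
    {p : WithLp 2 (H × K) × WithLp 2 (H × K)} (hp : p ∈ Pi.coupling Up R) (h0 : p.1 = 0) :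
    p.2 = 0 := by
  obtain ⟨⟨⟨f, f'⟩, hf⟩, ⟨⟨g, g'⟩, hg⟩, h₀, h₁, rfl⟩ := mem_coupling_iff.1 hp
  obtain rfl : f = 0 := congrArg WithLp.fst h0
  obtain rfl : g = 0 := congrArg WithLp.snd h0
  obtain rfl : g' = 0 := hT _ hg
  have hzero : (⟨(0, 0), hg⟩ : T.adjoint) = 0 := rfl
  rw [hzero, map_zero] at h₀ h₁
  rw [h₀, map_zero, sub_zero, neg_zero] at h₁
  obtain rfl : f' = 0 :=
    hD _ ((coe_mem_extension (f := ⟨(0, f'), hf⟩)).2 (by rw [h₀, h₁, map_zero]))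
  rfl

/-- `M` is the value at `z` of the Weyl function of the boundary triplet: `Γ₁ f̂ = M Γ₀ f̂` for all
`f̂ = {f, z f} ∈ S*`. -/
def IsWeylAt (Pi : BoundaryTriplet S G) (z : ℂ) (M : G →ₗ[ℂ] G) : Prop :=
  ∀ f : S.adjoint, f.1.2 = z • f.1.1 → Pi.Γ₁ f = M (Pi.Γ₀ f)

theorem fst_mem_extension_of_mem_coupling {z : ℂ} (hM : Up.IsWeylAt z M)
    {p : WithLp 2 (H × K) × WithLp 2 (H × K)} (hp : p ∈ Pi.coupling Up R)
    (hz : p.2.snd = z • p.1.snd) : (p.1.fst, p.2.fst) ∈ Pi.extension (R - M) := by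
  obtain ⟨f, g, h₀, h₁, rfl⟩ := mem_coupling_iff.1 hp
  refine (coe_mem_extension (f := f)).2 ?_
  rw [sub_eq_iff_eq_add.1 h₁, hM g hz, LinearMap.sub_apply, h₀]
  abel

theorem inner_snd_eq_zero_of_mem_coupling {z : ℂ} {e g g' : K}
    (he : (e, (starRingEnd ℂ) z • e) ∈ T.adjoint)
    (hp : (WithLp.toLp 2 ((0 : H), g), WithLp.toLp 2 ((0 : H), g')) ∈ Pi.coupling Up R) :
    ⟪e, g' - z • g⟫_ℂ = 0 := by
  obtain ⟨⟨⟨f, f'⟩, hf⟩, ⟨⟨k, k'⟩, hk⟩, h₀, h₁, h⟩ := mem_coupling_iff.1 hp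
  obtain ⟨hfst, hsnd⟩ := Prod.ext_iff.1 h
  obtain rfl : f = 0 := congrArg WithLp.fst hfst
  obtain rfl : k = g := congrArg WithLp.snd hfst
  obtain rfl : f' = 0 := congrArg WithLp.fst hsnd
  obtain rfl : k' = g' := congrArg WithLp.snd hsnd
  have hzero : (⟨(0, 0), hf⟩ : S.adjoint) = 0 := rfl
  rw [hzero, map_zero] at h₀ h₁
  rw [map_zero, map_zero, sub_zero, zero_eq_neg] at h₁
  have hgreen := Up.green ⟨_, hk⟩ ⟨_, he⟩
  simp only [← h₀, h₁, inner_zero_right, sub_zero, inner_smul_left, Complex.conj_conj] at hgreen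
  rw [inner_sub_right, inner_smul_right, hgreen]

end Coupling

section Dilation

variable [CompleteSpace H] [CompleteSpace K] {Pi : BoundaryTriplet S G}
  {Up : BoundaryTriplet T G} {R M : G →ₗ[ℂ] G} {L : WithLp 2 (H × K) →ₗ.[ℂ] WithLp 2 (H × K)}

theorem exists_compression_resolvent {z : ℂ} (hz : 0 < z.im) (hL : L.graph = Pi.coupling Up R)
    (hL' : L.graph.adjoint = L.graph) (hM : Up.IsWeylAt z M)
    (hD : LinRel.IsDissipative (R - M).graph) :
    ∃ (F : WithLp 2 (H × K) →L[ℂ] WithLp 2 (H × K)) (Q : H →L[ℂ] H),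
      LinRel.IsResolventAt L.graph z F ∧ LinRel.IsResolventAt (Pi.extension (R - M)) z Q ∧
      ∀ h : H, (F (WithLp.toLp 2 (h, 0))).fst = Q h := by
  obtain ⟨F, hF⟩ := LinRel.exists_isResolventAt hL' hz.ne'
  let e := WithLp.prodContinuousLinearEquiv 2 ℂ H K
  let Q : H →L[ℂ] H := ContinuousLinearMap.fst ℂ H K ∘L (e : WithLp 2 (H × K) →L[ℂ] H × K) ∘L
    F ∘L (e.symm : (H × K) →L[ℂ] WithLp 2 (H × K)) ∘L ContinuousLinearMap.inl ℂ H K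
  refine ⟨F, Q, hF, (isDissipative_extension hD).isResolventAt hz fun h => ?_, fun h => rfl⟩
  exact fst_mem_extension_of_mem_coupling hM (hL ▸ hF.mem (WithLp.toLp 2 (h, 0))) (by simp)

-- For `x` orthogonal to all `(L - z)⁻¹ H`, the vectors `(L - z)⁻¹ x` lie in `0 ⊕ K`, so all
-- boundary values of their components vanish and the `K`-part of `x` is orthogonal to every defect
-- element.
theorem span_resolvent_eq_top (hL : L.graph = Pi.coupling Up R)
    (hL' : L.graph.adjoint = L.graph) (hT : LinRel.IsSimple T) :
    (Submodule.span ℂ {u : WithLp 2 (H × K) |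
      ∃ (z : ℂ) (F : WithLp 2 (H × K) →L[ℂ] WithLp 2 (H × K)) (h : H),
        z.im ≠ 0 ∧ LinRel.IsResolventAt L.graph z F ∧
        u = F (WithLp.toLp 2 (h, 0))}).topologicalClosure = ⊤ := by
  rw [Submodule.topologicalClosure_eq_top_iff, Submodule.eq_bot_iff]
  intro x hx
  choose F hF using fun z : {z : ℂ // z.im ≠ 0} => LinRel.exists_isResolventAt hL' z.2
  have hFfst : ∀ z, (F z x).fst = 0 := fun z => by
    have hz : ((starRingEnd ℂ) z.1).im ≠ 0 := by simpa using z.2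
    refine ext_inner_left ℂ fun h => ?_
    have horth := (Submodule.mem_orthogonal _ _).1 hx _
      (Submodule.subset_span ⟨_, _, h, hz, hF ⟨_, hz⟩, rfl⟩)
    rw [← (hF z).inner_right hL'.ge (hF ⟨_, hz⟩)] at horth
    simpa [WithLp.prod_inner_apply] using horth
  have hxfst : x.fst = 0 := ext_inner_left ℂ fun h => by
    have hzero := LinRel.inner_eq_zero_of_inner_resolvent_eq_zero hL'.ge
      (LinRel.dense_domain_of_graph_adjoint_eq hL') (x := x) (u := WithLp.toLp 2 (h, (0 : K)))
      (R := fun t => if ht : 0 < t then F ⟨t * Complex.I, by simpa using ht.ne'⟩ x else 0)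
      (fun t ht => by simpa only [gt_iff_lt.1 ht, dite_true] using (hF _).mem x)
      (fun t ht => by simp [gt_iff_lt.1 ht, WithLp.prod_inner_apply, hFfst])
    simpa [WithLp.prod_inner_apply] using hzero
  have hxsnd : x.snd = 0 := hT _ fun w e hw he => by
    have hz : ((starRingEnd ℂ) w).im ≠ 0 := by simpa using hw
    have hmem := (hF ⟨_, hz⟩).mem x
    rw [hL] at hmem
    have hinner := inner_snd_eq_zero_of_mem_coupling (Pi := Pi) (Up := Up) (R := R)
      (z := (starRingEnd ℂ) w) (e := e) (g := (F ⟨_, hz⟩ x).snd)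
      (g' := x.snd + (starRingEnd ℂ) w • (F ⟨_, hz⟩ x).snd) (by rwa [Complex.conj_conj]) (by
        convert hmem using 1
        refine Prod.ext (WithLp.ofLp_injective 2 ?_) (WithLp.ofLp_injective 2 ?_) <;>
          refine Prod.ext ?_ ?_ <;> simp [hFfst, hxfst])
    rwa [add_sub_cancel_right] at hinner
  exact WithLp.ofLp_injective 2 (Prod.ext hxfst hxsnd)

theorem exists_isMinimalSelfadjointDilation (hS : S ≤ S.adjoint) (hT : T ≤ T.adjoint)
    (hTmul : ∀ g' : K, (0, g') ∈ T.adjoint → g' = 0) (hTsimple : LinRel.IsSimple T)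
    (hR : R.IsSymmetric) (hM : ∀ z : ℂ, 0 < z.im → Up.IsWeylAt z M)
    (hD : LinRel.IsDissipative (R - M).graph) {B : H →ₗ.[ℂ] H}
    (hB : B.graph = Pi.extension (R - M)) :
    ∃ L : WithLp 2 (H × K) →ₗ.[ℂ] WithLp 2 (H × K),
      L.graph = Pi.coupling Up R ∧ IsMinimalSelfadjointDilation L B := by
  have hmul : ∀ p ∈ Pi.coupling Up R, p.1 = 0 → p.2 = 0 := fun p =>
    eq_zero_of_zero_mem_coupling (fun f' hf' => B.graph_fst_eq_zero_snd (hB ▸ hf') rfl) hTmul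
  have hL := Submodule.toLinearPMap_graph_eq _ hmul
  have hL' := hL.symm ▸ adjoint_coupling hS hT hR
  refine ⟨_, hL, LinRel.isSelfAdjoint_of_graph_adjoint_eq hL', fun z hz => ?_,
    span_resolvent_eq_top hL hL' hTsimple⟩
  rw [hB]
  exact exists_compression_resolvent hz hL hL' (hM z hz) hD

end Dilation

end BoundaryTriplet

/-! ### Integration and primitives -/

section IntegrableFunctions

theorem absolutelyContinuousOnInterval_of_dist_le {X Y : Type*} [PseudoMetricSpace X]
    [PseudoMetricSpace Y] {f : ℝ → X} {g : ℝ → Y} {a b C : ℝ}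
    (hg : AbsolutelyContinuousOnInterval g a b)
    (h : ∀ x ∈ Set.uIcc a b, ∀ y ∈ Set.uIcc a b, dist (f x) (f y) ≤ C * dist (g x) (g y)) :
    AbsolutelyContinuousOnInterval f a b := by
  unfold AbsolutelyContinuousOnInterval at hg ⊢
  refine squeeze_zero' (.of_forall fun _ => Finset.sum_nonneg fun _ _ => dist_nonneg) ?_
    (by simpa using hg.const_mul C)
  rw [eventually_inf_principal]
  filter_upwards with J hJ
  rw [Finset.mul_sum]
  exact Finset.sum_le_sum fun i hi => h _ (hJ.1 i hi).1 _ (hJ.1 i hi).2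

variable {E : Type*} [NormedAddCommGroup E]

theorem intervalIntegrable_of_locallyIntegrable {w : ℝ → E} (hw : LocallyIntegrable w volume)
    (x y : ℝ) : IntervalIntegrable w volume x y :=
  intervalIntegrable_iff.2 <|
    (hw.integrableOn_isCompact isCompact_uIcc).mono_set Set.uIoc_subset_uIcc

variable {𝕜 : Type*} [RCLike 𝕜] [InnerProductSpace 𝕜 E]

theorem absolutelyContinuousOnInterval_inner {φ ψ : ℝ → E} {a b : ℝ}
    (hφ : AbsolutelyContinuousOnInterval φ a b) (hψ : AbsolutelyContinuousOnInterval ψ a b) :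
    AbsolutelyContinuousOnInterval (fun t => ⟪φ t, ψ t⟫_𝕜) a b := by
  obtain ⟨C, hC⟩ := hφ.exists_bound
  obtain ⟨K, hK⟩ := hψ.exists_bound
  unfold AbsolutelyContinuousOnInterval at hφ hψ ⊢
  refine squeeze_zero' (.of_forall fun _ => Finset.sum_nonneg fun _ _ => dist_nonneg) ?_
    (by simpa using (hψ.const_mul C).add (hφ.const_mul K))
  rw [eventually_inf_principal]
  filter_upwards with J hJ
  rw [Finset.mul_sum, Finset.mul_sum, ← Finset.sum_add_distrib]
  refine Finset.sum_le_sum fun i hi => ?_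
  set x := (J.2 i).1
  set y := (J.2 i).2
  have hx : ‖φ x‖ ≤ C := hC _ (hJ.1 i hi).1
  have hy : ‖ψ y‖ ≤ K := hK _ (hJ.1 i hi).2
  have product_rule : ⟪φ x, ψ x⟫_𝕜 - ⟪φ y, ψ y⟫_𝕜 = ⟪φ x, ψ x - ψ y⟫_𝕜 + ⟪φ x - φ y, ψ y⟫_𝕜 := by
    simp only [inner_sub_left, inner_sub_right]
    ring
  simp only [dist_eq_norm, product_rule]
  refine (norm_add_le _ _).trans (add_le_add ?_ ?_)
  · exact (norm_inner_le_norm _ _).trans (by gcongr)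
  · exact (norm_inner_le_norm _ _).trans (by rw [mul_comm]; gcongr)

theorem locallyIntegrable_inner_of_continuous_left {φ w : ℝ → E} (hφ : Continuous φ)
    (hw : LocallyIntegrable w volume) : LocallyIntegrable (fun t => ⟪φ t, w t⟫_𝕜) volume := by
  rw [locallyIntegrable_iff] at hw ⊢
  intro k hk
  obtain ⟨C, hC⟩ := hk.exists_bound_of_continuousOn hφ.continuousOn
  refine Integrable.mono' ((hw k hk).norm.const_mul C)
    (hφ.aestronglyMeasurable.inner (hw k hk).aestronglyMeasurable) ?_
  filter_upwards [ae_restrict_mem hk.measurableSet] with t ht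
  exact (norm_inner_le_norm _ _).trans (by gcongr; exact hC t ht)

theorem locallyIntegrable_inner_of_continuous_right {ψ w : ℝ → E}
    (hw : LocallyIntegrable w volume) (hψ : Continuous ψ) :
    LocallyIntegrable (fun t => ⟪w t, ψ t⟫_𝕜) volume := by
  rw [locallyIntegrable_iff]
  intro k hk
  have h := locallyIntegrable_iff.1 (locallyIntegrable_inner_of_continuous_left (𝕜 := 𝕜) hψ hw) k hk
  refine ((RCLike.conjCLE (K := 𝕜)).toContinuousLinearMap.integrable_comp h).congr
    (.of_forall fun t => ?_)
  exact inner_conj_symm _ _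

theorem exists_ae_eq_const_iUnion {X F : Type*} [MeasurableSpace X] {μ : Measure X} {u : X → F}
    {I : ℕ → Set X} (hI : Monotone I) (h0 : μ (I 0) ≠ 0)
    (h : ∀ m, ∃ c, ∀ᵐ x ∂μ.restrict (I m), u x = c) :
    ∃ c, ∀ᵐ x ∂μ.restrict (⋃ m, I m), u x = c := by
  choose c hc using h
  refine ⟨c 0, ?_⟩
  rw [ae_restrict_iUnion_iff]
  intro m
  have : (ae (μ.restrict (I 0))).NeBot := by
    rwa [ae_neBot, Ne, Measure.restrict_eq_zero]
  obtain ⟨x, hx0, hxm⟩ :=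
    ((hc 0).and (ae_mono (Measure.restrict_mono_set μ (hI (Nat.zero_le m))) (hc m))).exists
  rw [← hx0, hxm]
  exact hc m

theorem integrable_inner_of_memLp {X : Type*} [MeasurableSpace X] {μ : Measure X} {f g : X → E}
    (hf : MemLp f 2 μ) (hg : MemLp g 2 μ) : Integrable (fun x => ⟪f x, g x⟫_𝕜) μ := by
  refine (L2.integrable_inner (𝕜 := 𝕜) (hf.toLp f) (hg.toLp g)).congr ?_
  filter_upwards [hf.coeFn_toLp, hg.coeFn_toLp] with x hfx hgx
  rw [hfx, hgx]

theorem ae_eq_average_of_integral_inner_eq_zero {X : Type*} [MeasurableSpace X] {μ : Measure X}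
    [IsFiniteMeasure μ] [NormedSpace ℝ E] [CompleteSpace E] {u : X → E} (hu : MemLp u 2 μ)
    (h : ∀ k : X → E, MemLp k 2 μ → ∫ x, k x ∂μ = 0 → ∫ x, ⟪k x, u x⟫_𝕜 ∂μ = 0) :
    u =ᵐ[μ] fun _ => ⨍ x, u x ∂μ := by
  set c := ⨍ x, u x ∂μ
  have hk : MemLp (fun x => u x - c) 2 μ := hu.sub (memLp_const c)
  have hk0 : ∫ x, (u x - c) ∂μ = 0 := integral_sub_average μ u
  have hki : Integrable (fun x => u x - c) μ := hk.integrable (by norm_num)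
  have hkc : ∫ x, ⟪u x - c, c⟫_𝕜 ∂μ = 0 := by
    simp_rw [← inner_conj_symm _ c]
    rw [integral_conj, integral_inner hki, hk0, inner_zero_right, map_zero]
  have hkk : ∫ x, ⟪u x - c, u x - c⟫_𝕜 ∂μ = 0 := by
    simp_rw [inner_sub_right]
    rw [integral_sub (integrable_inner_of_memLp hk hu)
      (integrable_inner_of_memLp hk (memLp_const c)), h _ hk hk0,
      hkc, sub_zero]
  have hsq : ∫ x, ‖u x - c‖ ^ 2 ∂μ = 0 := by
    simp_rw [inner_self_eq_norm_sq_to_K] at hkk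
    exact_mod_cast hkk
  rw [integral_eq_zero_iff_of_nonneg (fun x => by positivity)
    ((memLp_two_iff_integrable_sq_norm hk.1).1 hk)] at hsq
  filter_upwards [hsq] with x hx
  simpa [sub_eq_zero] using hx

open scoped FourierTransform ContDiff in
theorem ae_eq_zero_of_fourier_eq_zero {V F : Type*} [NormedAddCommGroup V]
    [InnerProductSpace ℝ V] [MeasurableSpace V] [BorelSpace V] [FiniteDimensional ℝ V]
    [NormedAddCommGroup F] [NormedSpace ℂ F] [CompleteSpace F] {f : V → F}
    (hf : Integrable f volume) (h : 𝓕 f = 0) : f =ᵐ[volume] 0 := by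
  refine ae_eq_zero_of_integral_contDiff_smul_eq_zero hf.locallyIntegrable fun g hg hgc => ?_
  have hg₁ : HasCompactSupport (Complex.ofRealCLM ∘ g) := hgc.comp_left rfl
  have hg₂ : ContDiff ℝ ∞ (Complex.ofRealCLM ∘ g) := by fun_prop
  set G : SchwartzMap V ℂ := 𝓕⁻ (hg₁.toSchwartzMap hg₂) with hG
  have hGf : 𝓕 (G : V → ℂ) = Complex.ofRealCLM ∘ g := by
    rw [← SchwartzMap.fourier_coe, hG, FourierTransform.fourier_fourierInv_eq]
    rfl
  have duality : ∫ x, 𝓕 (G : V → ℂ) x • f x = ∫ x, G x • 𝓕 f x := by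
    have hflip : VectorFourier.fourierIntegral Real.fourierChar volume (innerₗ V).flip f = 𝓕 f := by
      rw [flip_innerₗ]
      rfl
    rw [← hflip]
    exact VectorFourier.integral_fourierIntegral_smul_eq_flip (L := innerₗ V)
        Real.continuous_fourierChar continuous_inner (G.integrable (μ := volume)) hf
  rw [hGf, h] at duality
  simpa using duality

end IntegrableFunctions

/-- `φ` is a primitive of `w` in the sense of Lebesgue integration: for locally integrable `w`, this
means that `φ` is locally absolutely continuous with derivative `w` almost everywhere. -/
def IsPrimitiveOf {E : Type*} [NormedAddCommGroup E] [NormedSpace ℝ E] (φ w : ℝ → E) : Prop :=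
  ∀ x y : ℝ, φ y - φ x = ∫ t in x..y, w t

namespace IsPrimitiveOf

section NormedSpace

variable {E : Type*} [NormedAddCommGroup E] [NormedSpace ℝ E] {φ w : ℝ → E}

theorem const_add_integral (hw : LocallyIntegrable w volume) (a : E) (c : ℝ) :
    IsPrimitiveOf (fun x => a + ∫ t in c..x, w t) w := fun x y => by
  rw [add_sub_add_left_eq_sub, intervalIntegral.integral_interval_sub_left
    (intervalIntegrable_of_locallyIntegrable hw _ _)
    (intervalIntegrable_of_locallyIntegrable hw _ _)]

theorem eq_const_add_integral (h : IsPrimitiveOf φ w) (c : ℝ) :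
    φ = fun x => φ c + ∫ t in c..x, w t := by
  ext1 x
  rw [← h, add_sub_cancel]

theorem continuous (h : IsPrimitiveOf φ w) (hw : LocallyIntegrable w volume) : Continuous φ := by
  rw [h.eq_const_add_integral 0]
  exact continuous_const.add
    (intervalIntegral.continuous_primitive (intervalIntegrable_of_locallyIntegrable hw) 0)

theorem eq_zero_of_notMem_Ioo (h : IsPrimitiveOf φ w) {α β : ℝ} (hα : φ α = 0) (hβ : φ β = 0)
    (hw : ∀ t ∉ Set.Ioc α β, w t = 0) {x : ℝ} (hx : x ∉ Set.Ioo α β) : φ x = 0 := by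
  have constant {c d : ℝ} (hcd : ∀ t ∈ Set.uIoc c d, t ∉ Set.Ioc α β) : φ d = φ c :=
    sub_eq_zero.1 <| (h c d).trans <|
      intervalIntegral.integral_zero_ae (.of_forall fun t ht => hw t (hcd t ht))
  rcases le_or_gt x α with hxα | hαx
  · rw [constant (c := α), hα]
    intro t ht ht'
    rw [Set.uIoc_of_ge hxα] at ht
    exact ht.2.not_gt ht'.1
  · have hβx : β ≤ x := not_lt.1 fun hxβ => hx ⟨hαx, hxβ⟩
    rw [constant (c := β), hβ]
    intro t ht ht'
    rw [Set.uIoc_of_le hβx] at ht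
    exact ht'.2.not_gt ht.1

theorem absolutelyContinuousOnInterval (h : IsPrimitiveOf φ w) (hw : LocallyIntegrable w volume)
    (a b : ℝ) : AbsolutelyContinuousOnInterval φ a b := by
  have hn : LocallyIntegrable (fun t => ‖w t‖) volume := fun x => (hw x).norm
  refine absolutelyContinuousOnInterval_of_dist_le (C := 1)
    (IntervalIntegrable.absolutelyContinuousOnInterval_intervalIntegral
      (intervalIntegrable_of_locallyIntegrable hn a b) (c := a) Set.left_mem_uIcc) fun x _ y _ => ?_
  rw [one_mul, dist_comm, dist_eq_norm, h, dist_comm, Real.dist_eq,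
    intervalIntegral.integral_interval_sub_left (intervalIntegrable_of_locallyIntegrable hn _ _)
      (intervalIntegrable_of_locallyIntegrable hn _ _)]
  exact intervalIntegral.norm_integral_le_abs_integral_norm

theorem ae_hasDerivAt [CompleteSpace E] (h : IsPrimitiveOf φ w) (hw : LocallyIntegrable w volume) :
    ∀ᵐ x, HasDerivAt φ (w x) x := by
  filter_upwards [_root_.LocallyIntegrable.ae_hasDerivAt_integral hw] with x hx
  rw [h.eq_const_add_integral 0]
  exact (hx 0).const_add _

theorem integral_Ioi (h : IsPrimitiveOf φ w) {c : ℝ} (hφ : IntegrableOn φ (Set.Ioi c))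
    (hw : IntegrableOn w (Set.Ioi c)) : ∫ t in Set.Ioi c, w t = -φ c := by
  have hlim : Tendsto φ atTop (𝓝 (φ c + ∫ t in Set.Ioi c, w t)) := by
    rw [h.eq_const_add_integral c]
    simpa using (intervalIntegral_tendsto_integral_Ioi c hw tendsto_id).const_add (φ c)
  refine eq_neg_of_add_eq_zero_right
    (IntegrableAtFilter.eq_zero_of_tendsto ⟨_, Ioi_mem_atTop c, hφ⟩ (fun s hs => ?_) hlim)
  obtain ⟨b, hb⟩ := mem_atTop_sets.1 hs
  rw [← top_le_iff, ← Real.volume_Ici (a := b)]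
  exact measure_mono hb

theorem integral_Iio (h : IsPrimitiveOf φ w) {c : ℝ} (hφ : IntegrableOn φ (Set.Iio c))
    (hw : IntegrableOn w (Set.Iio c)) : ∫ t in Set.Iio c, w t = φ c := by
  have hlim : Tendsto φ atBot (𝓝 (φ c - ∫ t in Set.Iio c, w t)) := by
    rw [h.eq_const_add_integral c, ← integral_Iic_eq_integral_Iio]
    simpa [intervalIntegral.integral_symm (b := c), sub_eq_add_neg] using
      (intervalIntegral_tendsto_integral_Iic c
        ((integrableOn_Iic_iff_integrableOn_Iio (by finiteness)).2 hw) tendsto_id).const_sub (φ c)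
  refine (sub_eq_zero.1
    (IntegrableAtFilter.eq_zero_of_tendsto ⟨_, Iio_mem_atBot c, hφ⟩ (fun s hs => ?_) hlim)).symm
  obtain ⟨b, hb⟩ := mem_atBot_sets.1 hs
  rw [← top_le_iff, ← Real.volume_Iic (a := b)]
  exact measure_mono hb

end NormedSpace

protected theorem inner {𝕜 E : Type*} [RCLike 𝕜] [NormedAddCommGroup E] [InnerProductSpace 𝕜 E]
    [NormedSpace ℝ E] [CompleteSpace E] {φ ψ w v : ℝ → E}
    (hφ : IsPrimitiveOf φ w) (hψ : IsPrimitiveOf ψ v)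
    (hw : LocallyIntegrable w volume) (hv : LocallyIntegrable v volume) :
    IsPrimitiveOf (fun t => ⟪φ t, ψ t⟫_𝕜) fun t => ⟪φ t, v t⟫_𝕜 + ⟪w t, ψ t⟫_𝕜 := by
  intro x y
  have hi : LocallyIntegrable (fun t => ⟪φ t, v t⟫_𝕜 + ⟪w t, ψ t⟫_𝕜) volume :=
    (locallyIntegrable_inner_of_continuous_left (hφ.continuous hw) hv).add
      (locallyIntegrable_inner_of_continuous_right hw (hψ.continuous hv))
  obtain ⟨F, hF⟩ : ∃ F : ℝ → 𝕜, IsPrimitiveOf F fun t => ⟪φ t, v t⟫_𝕜 + ⟪w t, ψ t⟫_𝕜 :=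
    ⟨_, const_add_integral hi 0 x⟩
  have hinner : AbsolutelyContinuousOnInterval (fun t => ⟪φ t, ψ t⟫_𝕜) x y :=
    absolutelyContinuousOnInterval_inner (hφ.absolutelyContinuousOnInterval hw x y)
      (hψ.absolutelyContinuousOnInterval hv x y)
  have hac : AbsolutelyContinuousOnInterval (fun t => ⟪φ t, ψ t⟫_𝕜 - F t) x y :=
    hinner.fun_sub (hF.absolutelyContinuousOnInterval hi x y)
  have hderiv : ∀ᵐ t, HasDerivAt (fun t => ⟪φ t, ψ t⟫_𝕜 - F t) 0 t := by
    filter_upwards [hφ.ae_hasDerivAt hw, hψ.ae_hasDerivAt hv, hF.ae_hasDerivAt hi]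
      with t hφt hψt hFt
    simpa only [sub_self] using (hφt.inner 𝕜 hψt).fun_sub hFt
  obtain ⟨C, hC⟩ := hac.const_of_ae_hasDerivAt_zero (hderiv.mono fun _ ht _ => ht)
  have hxy : ⟪φ x, ψ x⟫_𝕜 - F x = ⟪φ y, ψ y⟫_𝕜 - F y :=
    (hC x Set.left_mem_uIcc).trans (hC y Set.right_mem_uIcc).symm
  rw [← hF x y]
  linear_combination -hxy

end IsPrimitiveOf

/-! ### The operator `-i d/dx` on the punctured line -/

namespace Momentum

open FirstOrder

variable {n : ℕ} {p q : L2 n × L2 n} {a b c d : Cn n} {J : Set ℝ}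

theorem locallyIntegrable_L2 (w : L2 n) : LocallyIntegrable w volume :=
  (Lp.memLp w).locallyIntegrable (by norm_num)

theorem locallyIntegrable_I_smul_L2 (w : L2 n) :
    LocallyIntegrable (fun t => Complex.I • w t) volume :=
  (locallyIntegrable_L2 w).smul Complex.I

/-- The solution of `-i φ' = w`, `φ 0 = a`. -/
noncomputable def primitive (a : Cn n) (w : L2 n) (x : ℝ) : Cn n :=
  a + ∫ t in (0 : ℝ)..x, Complex.I • w t

@[simp]
theorem primitive_zero (a : Cn n) (w : L2 n) : primitive a w 0 = a := by simp [primitive]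

theorem isPrimitiveOf_primitive (a : Cn n) (w : L2 n) :
    IsPrimitiveOf (primitive a w) fun t => Complex.I • w t :=
  .const_add_integral (locallyIntegrable_I_smul_L2 w) a 0

theorem continuous_primitive (a : Cn n) (w : L2 n) : Continuous (primitive a w) :=
  (isPrimitiveOf_primitive a w).continuous (locallyIntegrable_I_smul_L2 w)

/-- The one-sided traces of an element `p = {g, g'}` of `T*`: `-i (dg/dx) = g'` on both half lines,
with boundary values `g(0+) = a` and `g(0-) = b`. -/
structure HasTraces (p : L2 n × L2 n) (a b : Cn n) : Prop where
  right : p.1 =ᵐ[volume.restrict (Set.Ioi 0)] primitive a p.2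
  left : p.1 =ᵐ[volume.restrict (Set.Iio 0)] primitive b p.2

section Green

theorem isPrimitiveOf_inner_primitive (a c : Cn n) (w v : L2 n) :
    IsPrimitiveOf (fun t => ⟪primitive a w t, primitive c v t⟫_ℂ) fun t =>
      ⟪primitive a w t, Complex.I • v t⟫_ℂ + ⟪Complex.I • w t, primitive c v t⟫_ℂ :=
  (isPrimitiveOf_primitive a w).inner (isPrimitiveOf_primitive c v)
    (locallyIntegrable_I_smul_L2 w) (locallyIntegrable_I_smul_L2 v)

theorem integrable_wronskian (p q : L2 n × L2 n) :
    Integrable (fun x => ⟪p.1 x, q.2 x⟫_ℂ - ⟪p.2 x, q.1 x⟫_ℂ) volume :=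
  (L2.integrable_inner p.1 q.2).sub (L2.integrable_inner p.2 q.1)

theorem wronskian_ae_eq (hp : p.1 =ᵐ[volume.restrict J] primitive a p.2)
    (hq : q.1 =ᵐ[volume.restrict J] primitive c q.2) :
    (fun x => Complex.I * (⟪p.1 x, q.2 x⟫_ℂ - ⟪p.2 x, q.1 x⟫_ℂ)) =ᵐ[volume.restrict J]
      fun t => ⟪primitive a p.2 t, Complex.I • q.2 t⟫_ℂ
        + ⟪Complex.I • p.2 t, primitive c q.2 t⟫_ℂ := by
  filter_upwards [hp, hq] with x hpx hqx
  rw [← hpx, ← hqx, inner_smul_left, inner_smul_right, Complex.conj_I]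
  ring

theorem integrableOn_inner_primitive (hp : p.1 =ᵐ[volume.restrict J] primitive a p.2)
    (hq : q.1 =ᵐ[volume.restrict J] primitive c q.2) :
    IntegrableOn (fun x => ⟪primitive a p.2 x, primitive c q.2 x⟫_ℂ) J := by
  refine (L2.integrable_inner p.1 q.1).integrableOn.congr ?_
  filter_upwards [hp, hq] with x hpx hqx
  rw [hpx, hqx]

theorem integral_Ioi_wronskian (hp : p.1 =ᵐ[volume.restrict (Set.Ioi 0)] primitive a p.2)
    (hq : q.1 =ᵐ[volume.restrict (Set.Ioi 0)] primitive c q.2) :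
    ∫ x in Set.Ioi 0, (⟪p.1 x, q.2 x⟫_ℂ - ⟪p.2 x, q.1 x⟫_ℂ) = Complex.I * ⟪a, c⟫_ℂ := by
  have h := (isPrimitiveOf_inner_primitive a c p.2 q.2).integral_Ioi
    (integrableOn_inner_primitive hp hq)
    (((integrable_wronskian p q).integrableOn.const_mul _).congr (wronskian_ae_eq hp hq))
  rw [← integral_congr_ae (wronskian_ae_eq hp hq), integral_const_mul, primitive_zero,
    primitive_zero] at h
  refine mul_left_cancel₀ Complex.I_ne_zero (h.trans ?_)
  rw [← mul_assoc, Complex.I_mul_I, neg_one_mul]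

theorem integral_Iio_wronskian (hp : p.1 =ᵐ[volume.restrict (Set.Iio 0)] primitive b p.2)
    (hq : q.1 =ᵐ[volume.restrict (Set.Iio 0)] primitive d q.2) :
    ∫ x in Set.Iio 0, (⟪p.1 x, q.2 x⟫_ℂ - ⟪p.2 x, q.1 x⟫_ℂ) = -(Complex.I * ⟪b, d⟫_ℂ) := by
  have h := (isPrimitiveOf_inner_primitive b d p.2 q.2).integral_Iio
    (integrableOn_inner_primitive hp hq)
    (((integrable_wronskian p q).integrableOn.const_mul _).congr (wronskian_ae_eq hp hq))
  rw [← integral_congr_ae (wronskian_ae_eq hp hq), integral_const_mul, primitive_zero,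
    primitive_zero] at h
  refine mul_left_cancel₀ Complex.I_ne_zero (h.trans ?_)
  rw [mul_neg, ← mul_assoc, Complex.I_mul_I, neg_one_mul, neg_neg]

theorem HasTraces.green (hp : HasTraces p a b) (hq : HasTraces q c d) :
    ⟪p.1, q.2⟫_ℂ - ⟪p.2, q.1⟫_ℂ = Complex.I * (⟪a, c⟫_ℂ - ⟪b, d⟫_ℂ) := by
  rw [L2.inner_def, L2.inner_def, ← integral_sub (L2.integrable_inner p.1 q.2)
    (L2.integrable_inner p.2 q.1), ← intervalIntegral.integral_Iic_add_Ioi (b := 0)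
    (integrable_wronskian p q).integrableOn (integrable_wronskian p q).integrableOn,
    integral_Iic_eq_integral_Iio, integral_Ioi_wronskian hp.right hq.right,
    integral_Iio_wronskian hp.left hq.left]
  ring

theorem hasTraces_zero_of_mem_T (hp : p ∈ T n) : HasTraces p 0 0 := by
  obtain ⟨φ, w, ⟨hφp, hφw⟩, hφ0, hpw⟩ := hp
  have h : p.1 =ᵐ[volume] primitive 0 p.2 := by
    filter_upwards [hφp] with x hx
    have hφx : φ x = ∫ t in (0 : ℝ)..x, w t := by rw [← hφw, hφ0, sub_zero]
    rw [← hx, hφx, primitive, zero_add]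
    refine intervalIntegral.integral_congr_ae ?_
    filter_upwards [Lp.coeFn_smul (-Complex.I) w] with t ht _
    rw [hpw, ht, Pi.smul_apply, smul_smul]
    simp
  exact ⟨ae_restrict_of_ae h, ae_restrict_of_ae h⟩

theorem HasTraces.mem_adjoint (hp : HasTraces p a b) : p ∈ (T n).adjoint := by
  rw [Submodule.mem_adjoint_iff]
  intro u v huv
  rw [eq_comm, ← sub_eq_zero]
  simpa using (hasTraces_zero_of_mem_T huv).green hp

theorem T_le_adjoint : T n ≤ (T n).adjoint := fun _ hp => (hasTraces_zero_of_mem_T hp).mem_adjoint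

end Green

theorem toLp_mem_T {ψ w : ℝ → Cn n} (hψ : MemLp ψ 2 volume) (hw : MemLp w 2 volume)
    (h : IsPrimitiveOf ψ w) (h0 : ψ 0 = 0) :
    (hψ.toLp ψ, (-Complex.I) • hw.toLp w) ∈ T n := by
  refine ⟨ψ, hw.toLp w, ⟨hψ.coeFn_toLp.symm, fun x y => ?_⟩, h0, rfl⟩
  rw [h]
  exact intervalIntegral.integral_congr_ae (hw.coeFn_toLp.mono fun t ht _ => ht.symm)

theorem inner_toLp_left {f : ℝ → Cn n} (hf : MemLp f 2 volume) (g : L2 n) :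
    ⟪hf.toLp f, g⟫_ℂ = ∫ t, ⟪f t, g t⟫_ℂ := by
  rw [L2.inner_def]
  refine integral_congr_ae ?_
  filter_upwards [hf.coeFn_toLp] with t ht
  rw [ht]

/-- The defining identity of the adjoint on the test function `ψ`, integrated by parts. -/
theorem integral_inner_sub_primitive_eq_zero (hp : p ∈ (T n).adjoint) {α β : ℝ}
    (h0 : (0 : ℝ) ∉ Set.Ioo α β) {ψ w : ℝ → Cn n} (hψ : IsPrimitiveOf ψ w)
    (hw : MemLp w 2 volume) (hw0 : ∀ t ∉ Set.Ioc α β, w t = 0) (hα : ψ α = 0) (hβ : ψ β = 0) :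
    ∫ t in α..β, ⟪w t, p.1 t - primitive 0 p.2 t⟫_ℂ = 0 := by
  have hwi : LocallyIntegrable w volume := hw.locallyIntegrable (by norm_num)
  have hψ0 {t : ℝ} (ht : t ∉ Set.Ioo α β) : ψ t = 0 := hψ.eq_zero_of_notMem_Ioo hα hβ hw0 ht
  have hψm : MemLp ψ 2 volume := (hψ.continuous hwi).memLp_of_hasCompactSupport
    (.intro isCompact_Icc fun t ht => hψ0 fun ht' => ht (Set.Ioo_subset_Icc_self ht'))
  have hψp : IntervalIntegrable (fun t => ⟪ψ t, Complex.I • p.2 t⟫_ℂ) volume α β :=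
    intervalIntegrable_of_locallyIntegrable (locallyIntegrable_inner_of_continuous_left
      (hψ.continuous hwi) (locallyIntegrable_I_smul_L2 p.2)) _ _
  have hwΦ : IntervalIntegrable (fun t => ⟪w t, primitive 0 p.2 t⟫_ℂ) volume α β :=
    intervalIntegrable_of_locallyIntegrable (locallyIntegrable_inner_of_continuous_right
      hwi (continuous_primitive 0 p.2)) _ _
  have hwp : IntervalIntegrable (fun t => ⟪w t, p.1 t⟫_ℂ) volume α β :=
    (integrable_inner_of_memLp hw (Lp.memLp p.1)).intervalIntegrable
  have adjoint_identity :
      ∫ t in α..β, ⟪ψ t, Complex.I • p.2 t⟫_ℂ = -∫ t in α..β, ⟪w t, p.1 t⟫_ℂ := by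
    have h := (Submodule.mem_adjoint_iff _ _).1 hp _ _ (toLp_mem_T hψm hw hψ (hψ0 h0))
    rw [inner_smul_left, inner_toLp_left, inner_toLp_left] at h
    rw [intervalIntegral.integral_eq_integral_of_support_subset,
      intervalIntegral.integral_eq_integral_of_support_subset]
    · simp_rw [inner_smul_right]
      rw [integral_const_mul, ← sub_eq_zero.1 h]
      simp [← mul_assoc]
    · exact fun t ht => by_contra fun ht' => ht (by simp [hw0 t ht'])
    · exact fun t ht => by_contra fun ht' =>
        ht (by simp [hψ0 fun h' => ht' (Set.Ioo_subset_Ioc_self h')])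
  have by_parts := hψ.inner (𝕜 := ℂ) (isPrimitiveOf_primitive 0 p.2) hwi
    (locallyIntegrable_I_smul_L2 p.2) α β
  beta_reduce at by_parts
  rw [intervalIntegral.integral_add hψp hwΦ, adjoint_identity, hα, hβ, inner_zero_left,
    inner_zero_left] at by_parts
  simp_rw [inner_sub_right]
  rw [intervalIntegral.integral_sub hwp hwΦ]
  linear_combination by_parts

theorem exists_ae_sub_primitive_eq_const (hp : p ∈ (T n).adjoint) {α β : ℝ} (hαβ : α ≤ β)
    (h0 : (0 : ℝ) ∉ Set.Ioo α β) :
    ∃ c, ∀ᵐ x ∂volume.restrict (Set.Ioc α β), p.1 x - primitive 0 p.2 x = c := by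
  have hΦ : MemLp (primitive 0 p.2) 2 (volume.restrict (Set.Ioc α β)) := by
    have hΦc := continuous_primitive 0 p.2
    obtain ⟨C, hC⟩ :=
      isCompact_Icc.exists_bound_of_continuousOn (hΦc.continuousOn (s := Set.Icc α β))
    refine .of_bound hΦc.aestronglyMeasurable C ?_
    filter_upwards [ae_restrict_mem measurableSet_Ioc] with x hx
    exact hC x (Set.Ioc_subset_Icc_self hx)
  refine ⟨_, ae_eq_average_of_integral_inner_eq_zero (𝕜 := ℂ) (((Lp.memLp p.1).restrict _).sub hΦ)
    fun k hk hk0 => ?_⟩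
  set w : ℝ → Cn n := (Set.Ioc α β).indicator k with hw_def
  have hw : MemLp w 2 volume := (memLp_indicator_iff_restrict measurableSet_Ioc).2 hk
  have hψ := IsPrimitiveOf.const_add_integral (hw.locallyIntegrable (by norm_num)) 0 α
  have hψβ : 0 + ∫ t in α..β, w t = 0 := by
    rw [zero_add, intervalIntegral.integral_of_le hαβ, ← hk0]
    exact setIntegral_congr_fun measurableSet_Ioc fun t ht => Set.indicator_of_mem ht k
  have h := integral_inner_sub_primitive_eq_zero hp h0 hψ hw
    (fun t ht => Set.indicator_of_notMem ht k) (by simp) hψβ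
  rw [intervalIntegral.integral_of_le hαβ] at h
  rw [← h]
  refine setIntegral_congr_fun measurableSet_Ioc fun t ht => ?_
  simp only [hw_def, Set.indicator_of_mem ht]

theorem exists_hasTraces_of_mem_adjoint (hp : p ∈ (T n).adjoint) : ∃ a b, HasTraces p a b := by
  have eq_primitive {c : Cn n} {x : ℝ} (h : p.1 x - primitive 0 p.2 x = c) :
      p.1 x = primitive c p.2 x := by
    rw [← h, primitive, primitive]
    abel
  obtain ⟨a, ha⟩ := exists_ae_eq_const_iUnion (μ := volume)
    (u := fun x => p.1 x - primitive 0 p.2 x) (I := fun m : ℕ => Set.Ioc (0 : ℝ) (m + 1))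
    (fun i j h => Set.Ioc_subset_Ioc_right (by gcongr)) (by simp)
    (fun m => exists_ae_sub_primitive_eq_const hp (by positivity) (by simp))
  obtain ⟨b, hb⟩ := exists_ae_eq_const_iUnion (μ := volume)
    (u := fun x => p.1 x - primitive 0 p.2 x) (I := fun m : ℕ => Set.Ioc (-(m + 1) : ℝ) 0)
    (fun i j h => Set.Ioc_subset_Ioc_left (by gcongr)) (by simp)
    (fun m => exists_ae_sub_primitive_eq_const hp (by linarith [m.cast_nonneg (α := ℝ)]) (by simp))
  refine ⟨a, b, ?_, ?_⟩
  · refine (ae_restrict_of_ae_restrict_of_subset (fun x hx => ?_) ha).mono fun x => eq_primitive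
    obtain ⟨m, hm⟩ := exists_nat_ge x
    exact Set.mem_iUnion.2 ⟨m, hx, by linarith⟩
  · refine (ae_restrict_of_ae_restrict_of_subset (fun x (hx : x < 0) => ?_) hb).mono
      fun x => eq_primitive
    obtain ⟨m, hm⟩ := exists_nat_ge (-x)
    exact Set.mem_iUnion.2 ⟨m, by linarith, hx.le⟩

section Traces

theorem isBoundaryValue_of_ae_eq_primitive (h : p.1 =ᵐ[volume.restrict J] primitive a p.2) :
    IsBoundaryValue J p.1 a := by
  refine ⟨primitive a p.2, h.symm, (continuous_primitive _ _).continuousOn, ?_⟩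
  have h0 := (continuous_primitive a p.2).continuousWithinAt (s := J) (x := 0)
  rwa [ContinuousWithinAt, primitive_zero] at h0

theorem eq_of_isBoundaryValue (hJ : IsOpen J) [(𝓝[J] (0 : ℝ)).NeBot] {g : L2 n}
    (ha : IsBoundaryValue J g a) (hb : IsBoundaryValue J g b) : a = b := by
  obtain ⟨φ, hφg, hφ, hφa⟩ := ha
  obtain ⟨ψ, hψg, hψ, hψb⟩ := hb
  have h : Set.EqOn φ ψ J := Measure.eqOn_open_of_ae_eq (hφg.trans hψg.symm) hJ hφ hψ
  exact tendsto_nhds_unique hφa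
    (hψb.congr' (eventually_nhdsWithin_of_forall fun x hx => (h hx).symm))

theorem HasTraces.unique (h : HasTraces p a b) (h' : HasTraces p c d) : a = c ∧ b = d :=
  ⟨eq_of_isBoundaryValue isOpen_Ioi (isBoundaryValue_of_ae_eq_primitive h.right)
    (isBoundaryValue_of_ae_eq_primitive h'.right),
   eq_of_isBoundaryValue isOpen_Iio (isBoundaryValue_of_ae_eq_primitive h.left)
    (isBoundaryValue_of_ae_eq_primitive h'.left)⟩

theorem hasTraces_iff : HasTraces p a b ↔
    p ∈ (T n).adjoint ∧ IsBoundaryValue (Set.Ioi 0) p.1 a ∧ IsBoundaryValue (Set.Iio 0) p.1 b := by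
  refine ⟨fun h => ⟨h.mem_adjoint, isBoundaryValue_of_ae_eq_primitive h.right,
    isBoundaryValue_of_ae_eq_primitive h.left⟩, fun ⟨hp, ha, hb⟩ => ?_⟩
  obtain ⟨a', b', h⟩ := exists_hasTraces_of_mem_adjoint hp
  rw [eq_of_isBoundaryValue isOpen_Ioi ha (isBoundaryValue_of_ae_eq_primitive h.right),
    eq_of_isBoundaryValue isOpen_Iio hb (isBoundaryValue_of_ae_eq_primitive h.left)]
  exact h

theorem HasTraces.add (hp : HasTraces p a b) (hq : HasTraces q c d) :
    HasTraces (p + q) (a + c) (b + d) := by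
  rw [hasTraces_iff] at *
  exact ⟨add_mem hp.1 hq.1, hp.2.1.add hq.2.1, hp.2.2.add hq.2.2⟩

theorem HasTraces.smul (z : ℂ) (hp : HasTraces p a b) : HasTraces (z • p) (z • a) (z • b) := by
  rw [hasTraces_iff] at *
  exact ⟨Submodule.smul_mem _ z hp.1, hp.2.1.smul z, hp.2.2.smul z⟩

theorem existsUnique_hasTraces (p : (T n).adjoint) :
    ∃! t : Cn n × Cn n, HasTraces p.1 t.1 t.2 := by
  obtain ⟨a, b, h⟩ := exists_hasTraces_of_mem_adjoint p.2
  exact ⟨(a, b), h, fun _ h' => Prod.ext (h'.unique h).1 (h'.unique h).2⟩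

/-- The traces `(g(0+), g(0-))` of the elements `{g, g'}` of `T*`. -/
noncomputable def traces : (T n).adjoint →ₗ[ℂ] Cn n × Cn n where
  toFun p := (existsUnique_hasTraces p).choose
  map_add' p q := ((existsUnique_hasTraces (p + q)).choose_spec.2 _
    ((existsUnique_hasTraces p).choose_spec.1.add (existsUnique_hasTraces q).choose_spec.1)).symm
  map_smul' z p := ((existsUnique_hasTraces (z • p)).choose_spec.2 _
    ((existsUnique_hasTraces p).choose_spec.1.smul z)).symm

theorem hasTraces_iff_traces_eq (p : (T n).adjoint) :
    HasTraces p.1 a b ↔ traces p = (a, b) := by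
  have hp : HasTraces p.1 (traces p).1 (traces p).2 := (existsUnique_hasTraces p).choose_spec.1
  refine ⟨fun h => Prod.ext (hp.unique h).1 (hp.unique h).2, fun h => ?_⟩
  rwa [h] at hp

theorem hasTraces_traces (p : (T n).adjoint) : HasTraces p.1 (traces p).1 (traces p).2 :=
  (hasTraces_iff_traces_eq p).2 rfl

theorem inner_smul_self_sub_inner_smul_self {E : Type*} [NormedAddCommGroup E]
    [InnerProductSpace ℂ E] (z : ℂ) (x : E) :
    ⟪x, z • x⟫_ℂ - ⟪z • x, x⟫_ℂ = 2 * z.im * Complex.I * ↑(‖x‖ ^ 2) := by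
  rw [inner_smul_left, inner_smul_right, ← sub_mul, Complex.sub_conj,
    inner_self_eq_norm_sq_to_K]
  push_cast
  rfl

/-- Green's identity on the left half line reads `2 Im z ∫ ‖g‖² = -‖b‖²`. -/
theorem HasTraces.left_eq_zero {g : L2 n} {z : ℂ} (hz : 0 < z.im)
    (h : HasTraces (g, z • g) a b) : b = 0 := by
  have wronskian : ∫ x in Set.Iio (0 : ℝ), (⟪g x, (z • g) x⟫_ℂ - ⟪(z • g) x, g x⟫_ℂ)
      = 2 * z.im * Complex.I * ↑(∫ x in Set.Iio (0 : ℝ), ‖g x‖ ^ 2) := by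
    rw [← integral_complex_ofReal, ← integral_const_mul]
    refine integral_congr_ae (ae_restrict_of_ae ?_)
    filter_upwards [Lp.coeFn_smul z g] with x hx
    rw [hx, Pi.smul_apply, inner_smul_self_sub_inner_smul_self]
  have green := integral_Iio_wronskian h.left h.left
  rw [wronskian, inner_self_eq_norm_sq_to_K] at green
  have norm_sq_eq : 2 * z.im * (∫ x in Set.Iio (0 : ℝ), ‖g x‖ ^ 2) = -‖b‖ ^ 2 := by
    refine Complex.ofReal_injective (mul_left_cancel₀ Complex.I_ne_zero ?_)
    rw [Complex.ofReal_mul, Complex.ofReal_mul, Complex.ofReal_neg, Complex.ofReal_pow]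
    exact (by push_cast; ring : _ = _).trans (green.trans (mul_neg _ _).symm)
  have integral_nonneg : 0 ≤ ∫ x in Set.Iio (0 : ℝ), ‖g x‖ ^ 2 :=
    integral_nonneg fun x => by positivity
  have : ‖b‖ ^ 2 ≤ 0 := by nlinarith [mul_nonneg hz.le integral_nonneg]
  exact norm_eq_zero.1 (pow_eq_zero_iff two_ne_zero |>.1 (this.antisymm (sq_nonneg _)))

end Traces

section Exponentials

open scoped FourierTransform

variable {V : Type*} [NormedAddCommGroup V] [NormedSpace ℂ V] {w : ℂ}

/-- The solution `x ↦ e^{iwx} c` of `-i g' = w g`. -/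
noncomputable def expSol (w : ℂ) (c : V) (x : ℝ) : V :=
  Complex.exp (Complex.I * w * x) • c

theorem hasDerivAt_expSol (w : ℂ) (c : V) (x : ℝ) :
    HasDerivAt (expSol w c) (Complex.I • w • expSol w c x) x := by
  have h : HasDerivAt (fun y : ℝ => Complex.I * w * (y : ℂ)) (Complex.I * w) x := by
    simpa using (Complex.ofRealCLM.hasDerivAt (x := x)).const_mul (Complex.I * w)
  refine (h.cexp.smul_const c).congr_deriv ?_
  rw [expSol, smul_smul, smul_smul, mul_comm]

theorem continuous_expSol (w : ℂ) (c : V) : Continuous (expSol w c) := by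
  unfold expSol
  fun_prop

theorem norm_expSol (w : ℂ) (c : V) (x : ℝ) : ‖expSol w c x‖ = Real.exp (-w.im * x) * ‖c‖ := by
  rw [expSol, norm_smul, Complex.norm_exp]
  simp

theorem memLp_indicator_expSol (hJ : MeasurableSet J)
    (h : IntegrableOn (fun x => Real.exp (-(2 * w.im) * x)) J) (c : V) :
    MemLp (J.indicator (expSol w c)) 2 volume := by
  rw [memLp_indicator_iff_restrict hJ,
    memLp_two_iff_integrable_sq_norm (continuous_expSol w c).aestronglyMeasurable]
  refine (h.mul_const (‖c‖ ^ 2)).congr (.of_forall fun x => ?_)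
  dsimp only
  rw [norm_expSol, mul_pow, ← Real.exp_nat_mul]
  congr 2
  push_cast
  ring

theorem integrableOn_exp_Ioi (hw : 0 < w.im) :
    IntegrableOn (fun x => Real.exp (-(2 * w.im) * x)) (Set.Ioi 0) :=
  integrableOn_exp_mul_Ioi (by linarith) 0

theorem integrableOn_exp_Iic (hw : w.im < 0) :
    IntegrableOn (fun x => Real.exp (-(2 * w.im) * x)) (Set.Iic 0) :=
  integrableOn_exp_mul_Iic (by linarith) 0

theorem primitive_indicator_expSol (hm : MemLp (J.indicator (expSol w c)) 2 volume) {x : ℝ}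
    (hx : Set.uIoc 0 x ⊆ J) : primitive c (w • hm.toLp _) x = expSol w c x := by
  have h : ∫ t in (0 : ℝ)..x, Complex.I • (w • hm.toLp _ : L2 n) t
      = ∫ t in (0 : ℝ)..x, Complex.I • w • expSol w c t := by
    refine intervalIntegral.integral_congr_ae ?_
    filter_upwards [Lp.coeFn_smul w (hm.toLp _), hm.coeFn_toLp] with t hwt hmt ht
    rw [hwt, Pi.smul_apply, hmt, Set.indicator_of_mem (hx ht)]
  rw [primitive, h, intervalIntegral.integral_eq_sub_of_hasDerivAt
    (fun t _ => hasDerivAt_expSol w c t)]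
  · simp [expSol]
  · exact (((continuous_expSol w c).const_smul w).const_smul Complex.I).intervalIntegrable _ _

theorem primitive_indicator_expSol_eq_zero (hm : MemLp (J.indicator (expSol w c)) 2 volume)
    {x : ℝ} (hx : Set.uIoc 0 x ⊆ Jᶜ) : primitive 0 (w • hm.toLp _) x = 0 := by
  rw [primitive, zero_add]
  refine intervalIntegral.integral_zero_ae ?_
  filter_upwards [Lp.coeFn_smul w (hm.toLp _), hm.coeFn_toLp] with t hwt hmt ht
  rw [hwt, Pi.smul_apply, hmt, Set.indicator_of_notMem (hx ht), smul_zero, smul_zero]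

theorem hasTraces_expSol_right (hm : MemLp ((Set.Ioi 0).indicator (expSol w c)) 2 volume) :
    HasTraces (hm.toLp _, w • hm.toLp _) c 0 := by
  constructor
  · filter_upwards [ae_restrict_of_ae hm.coeFn_toLp, ae_restrict_mem measurableSet_Ioi]
      with x hmx (hx : 0 < x)
    rw [hmx, Set.indicator_of_mem (Set.mem_Ioi.2 hx), primitive_indicator_expSol hm]
    rw [Set.uIoc_of_le hx.le]
    exact fun t ht => ht.1
  · filter_upwards [ae_restrict_of_ae hm.coeFn_toLp, ae_restrict_mem measurableSet_Iio]
      with x hmx (hx : x < 0)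
    rw [hmx, Set.indicator_of_notMem (Set.notMem_Ioi.2 hx.le),
      primitive_indicator_expSol_eq_zero hm]
    rw [Set.uIoc_of_ge hx.le]
    exact fun t ht => not_lt.2 ht.2

theorem hasTraces_expSol_left (hm : MemLp ((Set.Iic 0).indicator (expSol w c)) 2 volume) :
    HasTraces (hm.toLp _, w • hm.toLp _) 0 c := by
  constructor
  · filter_upwards [ae_restrict_of_ae hm.coeFn_toLp, ae_restrict_mem measurableSet_Ioi]
      with x hmx (hx : 0 < x)
    rw [hmx, Set.indicator_of_notMem (Set.notMem_Iic.2 hx), primitive_indicator_expSol_eq_zero hm]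
    rw [Set.uIoc_of_le hx.le]
    exact fun t ht => not_le.2 ht.1
  · filter_upwards [ae_restrict_of_ae hm.coeFn_toLp, ae_restrict_mem measurableSet_Iio]
      with x hmx (hx : x < 0)
    rw [hmx, Set.indicator_of_mem (Set.mem_Iic.2 hx.le), primitive_indicator_expSol hm]
    rw [Set.uIoc_of_ge hx.le]
    exact fun t ht => ht.2

theorem exists_hasTraces (a b : Cn n) : ∃ p : L2 n × L2 n, HasTraces p a b := by
  have ha := hasTraces_expSol_right (memLp_indicator_expSol measurableSet_Ioi
    (integrableOn_exp_Ioi (w := Complex.I) (by simp)) a)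
  have hb := hasTraces_expSol_left (memLp_indicator_expSol measurableSet_Iic
    (integrableOn_exp_Iic (w := -Complex.I) (by simp)) b)
  exact ⟨_, by simpa using ha.add hb⟩

theorem integrable_indicator_expSol_smul
    (hm : MemLp (J.indicator (expSol w (1 : ℂ))) 2 volume) (v : L2 n) :
    Integrable (J.indicator fun x => expSol w (1 : ℂ) x • v x) volume := by
  rw [← memLp_one_iff_integrable]
  refine ((Lp.memLp v).smul (r := 1) hm).ae_eq (.of_forall fun x => ?_)
  by_cases hx : x ∈ J <;> simp [hx]

/-- With `w = 2πs + iε`, the factor `e^{-εx}` of the exponential is a weight and the oscillating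
factor is the Fourier kernel. -/
theorem inner_fourier_indicator_expSol_smul {ε : ℝ} {v : L2 n}
    (hv : Integrable (J.indicator fun x => expSol (ε * Complex.I) (1 : ℂ) x • v x) volume)
    (s : ℝ) (hm : MemLp (J.indicator
      (expSol ((2 * Real.pi * s : ℝ) + ε * Complex.I) c)) 2 volume) :
    ⟪c, 𝓕 (J.indicator fun x => expSol (ε * Complex.I) (1 : ℂ) x • v x) s⟫_ℂ
      = ⟪hm.toLp _, v⟫_ℂ := by
  rw [Real.fourier_real_eq_integral_exp_smul, ← integral_inner, inner_toLp_left]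
  · refine integral_congr_ae (.of_forall fun x => ?_)
    by_cases hx : x ∈ J
    · simp only [Set.indicator_of_mem hx, expSol, smul_smul, smul_eq_mul, mul_one,
        inner_smul_left, inner_smul_right, ← Complex.exp_conj, ← Complex.exp_add]
      congr 2
      simp only [map_mul, map_add, Complex.conj_I, Complex.conj_ofReal]
      push_cast
      ring
    · simp only [Set.indicator_of_notMem hx, smul_zero, inner_zero_right, inner_zero_left]
  · exact hv.bdd_smul 1 (Continuous.aestronglyMeasurable (by fun_prop))
      (.of_forall fun x => (Complex.norm_exp_ofReal_mul_I _).le)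

theorem indicator_ae_eq_zero_of_inner_expSol (hJ : MeasurableSet J) {ε : ℝ}
    (hε : IntegrableOn (fun x => Real.exp (-(2 * ε) * x)) J) (v : L2 n)
    (h : ∀ (w : ℂ) (c : Cn n), w.im = ε →
      ∀ hm : MemLp (J.indicator (expSol w c)) 2 volume, ⟪hm.toLp _, v⟫_ℂ = 0) :
    J.indicator v =ᵐ[volume] 0 := by
  have integrable_weighted : Integrable
      (J.indicator fun x => expSol (ε * Complex.I) (1 : ℂ) x • v x) volume :=
    integrable_indicator_expSol_smul (memLp_indicator_expSol hJ (by simpa using hε) 1) v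
  have fourier_eq_zero : 𝓕 (J.indicator fun x => expSol (ε * Complex.I) (1 : ℂ) x • v x) = 0 := by
    funext s
    refine ext_inner_left ℂ fun c => ?_
    have hm : MemLp (J.indicator (expSol ((2 * Real.pi * s : ℝ) + ε * Complex.I) c)) 2 volume :=
      memLp_indicator_expSol hJ (by simpa using hε) c
    rw [inner_fourier_indicator_expSol_smul integrable_weighted s hm, h _ c (by simp) hm,
      Pi.zero_apply, inner_zero_right]
  filter_upwards [ae_eq_zero_of_fourier_eq_zero integrable_weighted fourier_eq_zero] with x hx
  by_cases hxJ : x ∈ J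
  · simpa [hxJ, expSol, Complex.exp_ne_zero] using hx
  · simp [hxJ]

theorem isSimple_T : LinRel.IsSimple (T n) := by
  intro v hv
  have hright := indicator_ae_eq_zero_of_inner_expSol measurableSet_Ioi (ε := 1)
    (by simpa using integrableOn_exp_Ioi (w := Complex.I) (by simp)) v
    fun w c hw hm => hv w _ (by simp [hw]) (hasTraces_expSol_right hm).mem_adjoint
  have hleft := indicator_ae_eq_zero_of_inner_expSol measurableSet_Iic (ε := -1)
    (by simpa using integrableOn_exp_Iic (w := -Complex.I) (by simp)) v
    fun w c hw hm => hv w _ (by simp [hw]) (hasTraces_expSol_left hm).mem_adjoint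
  rw [Lp.eq_zero_iff_ae_eq_zero]
  filter_upwards [hright, hleft] with x hxr hxl
  rcases lt_or_ge 0 x with hx | hx
  · rwa [Set.indicator_of_mem (Set.mem_Ioi.2 hx)] at hxr
  · rwa [Set.indicator_of_mem (Set.mem_Iic.2 hx)] at hxl

theorem eq_zero_of_zero_mem_adjoint {v : L2 n} (hv : ((0 : L2 n), v) ∈ (T n).adjoint) :
    v = 0 := by
  obtain ⟨a, b, h⟩ := exists_hasTraces_of_mem_adjoint hv
  have ha : a = 0 :=
    eq_of_isBoundaryValue isOpen_Ioi (isBoundaryValue_of_ae_eq_primitive h.right) (.zero _)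
  have hb : b = 0 :=
    eq_of_isBoundaryValue isOpen_Iio (isBoundaryValue_of_ae_eq_primitive h.left) (.zero _)
  refine isSimple_T v fun z e _ he => ?_
  obtain ⟨c, d, h'⟩ := exists_hasTraces_of_mem_adjoint he
  simpa [ha, hb] using h'.green h

end Exponentials

end Momentum

/-! ### The boundary triplet `{Υ₀, Υ₁}` and the dilation -/

namespace Momentum

open FirstOrder

variable {n : ℕ} {D : Matrix (Fin n) (Fin n) ℂ} {a b : Cn n}

section SqrtNegIm

open scoped MatrixOrder

theorem toEuclideanLin_eq_realPart_add (D : Matrix (Fin n) (Fin n) ℂ) :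
    Matrix.toEuclideanLin D = Matrix.toEuclideanLin (ℜ D : Matrix (Fin n) (Fin n) ℂ)
      + Complex.I • Matrix.toEuclideanLin (ℑ D : Matrix (Fin n) (Fin n) ℂ) := by
  conv_lhs => rw [← realPart_add_I_smul_imaginaryPart D, map_add, map_smul]

theorem isSymmetric_toEuclideanLin {A : Matrix (Fin n) (Fin n) ℂ} (hA : IsSelfAdjoint A) :
    (Matrix.toEuclideanLin A).IsSymmetric :=
  Matrix.isSymmetric_toEuclideanLin_iff.2 hA

theorem nonneg_neg_imaginaryPart (hD : LinRel.IsDissipative (Matrix.toEuclideanLin D).graph) :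
    0 ≤ -(ℑ D : Matrix (Fin n) (Fin n) ℂ) := by
  have hIm := isSymmetric_toEuclideanLin (ℑ D).2
  refine Matrix.PosSemidef.nonneg (Matrix.isPositive_toEuclideanLin_iff.1 ⟨?_, fun x => ?_⟩)
  · exact isSymmetric_toEuclideanLin (ℑ D).2.neg
  · have h := hD (x, Matrix.toEuclideanLin D x) rfl
    have hRe : (⟪x, Matrix.toEuclideanLin (ℜ D : Matrix (Fin n) (Fin n) ℂ) x⟫_ℂ).im = 0 :=
      (isSymmetric_toEuclideanLin (ℜ D).2).im_inner_self_apply x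
    rw [toEuclideanLin_eq_realPart_add, LinearMap.add_apply, LinearMap.smul_apply,
      inner_add_right, inner_smul_right, Complex.add_im, hRe, zero_add, Complex.I_mul_im] at h
    rw [map_neg, LinearMap.neg_apply, inner_neg_left, hIm x x]
    simpa using h

theorem sqrtNegIm_mul_self (hD : LinRel.IsDissipative (Matrix.toEuclideanLin D).graph) :
    sqrtNegIm D * sqrtNegIm D = -(ℑ D : Matrix (Fin n) (Fin n) ℂ) :=
  CFC.sqrt_mul_sqrt_self _ (nonneg_neg_imaginaryPart hD)

theorem isSymmetric_sqrtNegIm (D : Matrix (Fin n) (Fin n) ℂ) :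
    (Matrix.toEuclideanLin (sqrtNegIm D)).IsSymmetric :=
  isSymmetric_toEuclideanLin (.of_nonneg (CFC.sqrt_nonneg _))

theorem isUnit_det_sqrtNegIm (hD : LinRel.IsDissipative (Matrix.toEuclideanLin D).graph)
    (hImD : LinearMap.ker (Matrix.toEuclideanLin (ℑ D : Matrix (Fin n) (Fin n) ℂ)) = ⊥) :
    IsUnit (sqrtNegIm D).det := by
  have h : IsUnit (ℑ D : Matrix (Fin n) (Fin n) ℂ) := by
    refine Matrix.mulVec_injective_iff_isUnit.1 fun x y hxy => WithLp.toLp_injective 2 ?_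
    exact LinearMap.ker_eq_bot.1 hImD (congrArg (WithLp.toLp 2) hxy)
  rw [← IsUnit.neg_iff, ← sqrtNegIm_mul_self hD, Matrix.isUnit_iff_isUnit_det, Matrix.det_mul] at h
  exact isUnit_of_mul_isUnit_left h

theorem toEuclideanLin_inv_apply {A : Matrix (Fin n) (Fin n) ℂ} (hA : IsUnit A.det) (x : Cn n) :
    Matrix.toEuclideanLin A⁻¹ (Matrix.toEuclideanLin A x) = x := by
  rw [← LinearMap.comp_apply, ← Matrix.toLpLin_mul_same, Matrix.nonsing_inv_mul _ hA,
    Matrix.toLpLin_one, LinearMap.id_apply]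

theorem toEuclideanLin_apply_inv {A : Matrix (Fin n) (Fin n) ℂ} (hA : IsUnit A.det) (x : Cn n) :
    Matrix.toEuclideanLin A (Matrix.toEuclideanLin A⁻¹ x) = x := by
  rw [← LinearMap.comp_apply, ← Matrix.toLpLin_mul_same, Matrix.mul_nonsing_inv _ hA,
    Matrix.toLpLin_one, LinearMap.id_apply]

end SqrtNegIm

section Upsilon

theorem inner_upsilon₀_upsilon₁ (h : IsUnit (sqrtNegIm D).det) (a b c d : Cn n) :
    ⟪upsilon₀ D a b, upsilon₁ D c d⟫_ℂ = Complex.I / 2 * ⟪a - b, c + d⟫_ℂ := by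
  have sqrt_two : (1 / (Real.sqrt 2 : ℂ)) * (Complex.I / Real.sqrt 2) = Complex.I / 2 := by
    rw [div_mul_div_comm, ← Complex.ofReal_mul, Real.mul_self_sqrt zero_le_two, one_mul,
      Complex.ofReal_ofNat]
  rw [upsilon₀, upsilon₁, inner_smul_left, inner_smul_right, ← isSymmetric_sqrtNegIm D,
    toEuclideanLin_apply_inv h, map_div₀, map_one, Complex.conj_ofReal, ← mul_assoc, sqrt_two]

theorem inner_upsilon₁_upsilon₀ (h : IsUnit (sqrtNegIm D).det) (a b c d : Cn n) :
    ⟪upsilon₁ D a b, upsilon₀ D c d⟫_ℂ = -(Complex.I / 2) * ⟪a + b, c - d⟫_ℂ := by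
  rw [← inner_conj_symm, inner_upsilon₀_upsilon₁ h, map_mul, inner_conj_symm, map_div₀,
    Complex.conj_I, Complex.conj_ofNat, neg_div]

theorem upsilon_surjective (h : IsUnit (sqrtNegIm D).det) (x y : Cn n) :
    ∃ a b, upsilon₀ D a b = x ∧ upsilon₁ D a b = y := by
  have sqrt_two_ne_zero : (Real.sqrt 2 : ℂ) ≠ 0 := Complex.ofReal_ne_zero.2 (by positivity)
  obtain ⟨u, hu⟩ : ∃ u : Cn n, (1 / (Real.sqrt 2 : ℂ)) •
      Matrix.toEuclideanLin (sqrtNegIm D)⁻¹ u = x :=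
    ⟨(Real.sqrt 2 : ℂ) • Matrix.toEuclideanLin (sqrtNegIm D) x, by
      rw [map_smul, toEuclideanLin_inv_apply h, smul_smul, one_div_mul_cancel sqrt_two_ne_zero,
        one_smul]⟩
  obtain ⟨v, hv⟩ : ∃ v : Cn n, (Complex.I / (Real.sqrt 2 : ℂ)) •
      Matrix.toEuclideanLin (sqrtNegIm D) v = y :=
    ⟨(Real.sqrt 2 / Complex.I : ℂ) • Matrix.toEuclideanLin (sqrtNegIm D)⁻¹ y, by
      rw [map_smul, toEuclideanLin_apply_inv h, smul_smul, div_mul_div_cancel₀ sqrt_two_ne_zero,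
        div_self Complex.I_ne_zero, one_smul]⟩
  refine ⟨(1 / 2 : ℂ) • (v + u), (1 / 2 : ℂ) • (v - u), ?_, ?_⟩
  · rw [← hu, upsilon₀]
    congr 2
    module
  · rw [← hv, upsilon₁]
    congr 2
    module

/-- The boundary triplet `{ℂⁿ, Υ₀, Υ₁}` for `T*`. -/
noncomputable def upsilonTriplet (h : IsUnit (sqrtNegIm D).det) : BoundaryTriplet (T n) (Cn n) where
  Γ₀ := (1 / (Real.sqrt 2 : ℂ)) • Matrix.toEuclideanLin (sqrtNegIm D)⁻¹ ∘ₗ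
    (LinearMap.fst ℂ (Cn n) (Cn n) - LinearMap.snd ℂ (Cn n) (Cn n)) ∘ₗ traces
  Γ₁ := (Complex.I / (Real.sqrt 2 : ℂ)) • Matrix.toEuclideanLin (sqrtNegIm D) ∘ₗ
    (LinearMap.fst ℂ (Cn n) (Cn n) + LinearMap.snd ℂ (Cn n) (Cn n)) ∘ₗ traces
  green f g := by
    refine ((hasTraces_traces g).green (hasTraces_traces f)).trans (Eq.trans ?_ (congrArg₂ _
      (inner_upsilon₀_upsilon₁ h _ _ _ _) (inner_upsilon₁_upsilon₀ h _ _ _ _)).symm)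
    simp only [inner_add_left, inner_add_right, inner_sub_left, inner_sub_right,
      LinearMap.fst_apply, LinearMap.snd_apply]
    ring
  surjective := fun ⟨x, y⟩ => by
    obtain ⟨a, b, rfl, rfl⟩ := upsilon_surjective h x y
    obtain ⟨p, hp⟩ := exists_hasTraces a b
    have htraces := (hasTraces_iff_traces_eq ⟨p, hp.mem_adjoint⟩).1 hp
    refine ⟨⟨p, hp.mem_adjoint⟩, ?_⟩
    simp [htraces, upsilon₀, upsilon₁]

theorem upsilonTriplet_Γ₀ (h : IsUnit (sqrtNegIm D).det) {p : (T n).adjoint}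
    (hp : traces p = (a, b)) : (upsilonTriplet h).Γ₀ p = upsilon₀ D a b := by
  simp [upsilonTriplet, upsilon₀, hp]

theorem upsilonTriplet_Γ₁ (h : IsUnit (sqrtNegIm D).det) {p : (T n).adjoint}
    (hp : traces p = (a, b)) : (upsilonTriplet h).Γ₁ p = upsilon₁ D a b := by
  simp [upsilonTriplet, upsilon₁, hp]

theorem isWeylAt_upsilonTriplet (hD : LinRel.IsDissipative (Matrix.toEuclideanLin D).graph)
    (h : IsUnit (sqrtNegIm D).det) {z : ℂ} (hz : 0 < z.im) :
    (upsilonTriplet h).IsWeylAt z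
      (-(Complex.I • Matrix.toEuclideanLin (ℑ D : Matrix (Fin n) (Fin n) ℂ))) := by
  rintro ⟨⟨g, g'⟩, hg⟩ (rfl : g' = z • g)
  obtain ⟨a, b, hab⟩ := exists_hasTraces_of_mem_adjoint hg
  obtain rfl : b = 0 := hab.left_eq_zero hz
  have htraces := (hasTraces_iff_traces_eq ⟨_, hg⟩).1 hab
  have sq (x : Cn n) : -Matrix.toEuclideanLin (ℑ D : Matrix (Fin n) (Fin n) ℂ) x
      = Matrix.toEuclideanLin (sqrtNegIm D) (Matrix.toEuclideanLin (sqrtNegIm D) x) := by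
    rw [← LinearMap.neg_apply, ← map_neg, ← sqrtNegIm_mul_self hD, Matrix.toLpLin_mul_same,
      LinearMap.comp_apply]
  rw [upsilonTriplet_Γ₀ h htraces, upsilonTriplet_Γ₁ h htraces, LinearMap.neg_apply,
    LinearMap.smul_apply, ← smul_neg, sq, upsilon₀, upsilon₁, map_smul, map_smul, sub_zero,
    add_zero, toEuclideanLin_apply_inv h, smul_smul, mul_one_div]

end Upsilon

end Momentum

section Dilation

open FirstOrder Momentum

variable {H : Type*} [NormedAddCommGroup H] [InnerProductSpace ℂ H] {n : ℕ}
  {S : Submodule ℂ (H × H)} {D : Matrix (Fin n) (Fin n) ℂ}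

theorem couplingRelation_eq_coupling (Pi : BoundaryTriplet S (Cn n))
    (h : IsUnit (sqrtNegIm D).det) :
    couplingRelation Pi D = Pi.coupling (upsilonTriplet h)
      (Matrix.toEuclideanLin (ℜ D : Matrix (Fin n) (Fin n) ℂ)) := by
  ext p
  rw [BoundaryTriplet.mem_coupling_iff]
  constructor
  · rintro ⟨hf, a, b, hg, ha, hb, h₀, h₁⟩
    have htraces := (hasTraces_iff_traces_eq ⟨_, hg⟩).1 (hasTraces_iff.2 ⟨hg, ha, hb⟩)
    refine ⟨⟨_, hf⟩, ⟨_, hg⟩, ?_, ?_, rfl⟩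
    · rw [upsilonTriplet_Γ₀ h htraces, h₀]
    · rw [upsilonTriplet_Γ₁ h htraces, h₁]
  · rintro ⟨f, g, h₀, h₁, rfl⟩
    obtain ⟨hg, ha, hb⟩ := hasTraces_iff.1 (hasTraces_traces g)
    rw [upsilonTriplet_Γ₀ h rfl] at h₀
    rw [upsilonTriplet_Γ₁ h rfl] at h₁
    exact ⟨f.2, _, _, hg, ha, hb, h₀, h₁⟩

theorem theorem4p2_general [CompleteSpace H] (hS : S ≤ S.adjoint) (Pi : BoundaryTriplet S (Cn n))
    (hD : LinRel.IsDissipative (Matrix.toEuclideanLin D).graph)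
    (hImD : LinearMap.ker (Matrix.toEuclideanLin (ℑ D : Matrix (Fin n) (Fin n) ℂ)) = ⊥)
    {B : H →ₗ.[ℂ] H} (hB : B.graph = Pi.extension (Matrix.toEuclideanLin D)) :
    ∃ L : WithLp 2 (H × L2 n) →ₗ.[ℂ] WithLp 2 (H × L2 n),
      L.graph = couplingRelation Pi D ∧ IsMinimalSelfadjointDilation L B := by
  have hU : IsUnit (sqrtNegIm D).det := isUnit_det_sqrtNegIm hD hImD
  have hRe := isSymmetric_toEuclideanLin (ℜ D).2
  have hWeyl (z : ℂ) (hz : 0 < z.im) := isWeylAt_upsilonTriplet hD hU hz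
  rw [couplingRelation_eq_coupling Pi hU]
  rw [toEuclideanLin_eq_realPart_add, ← sub_neg_eq_add] at hB hD
  exact BoundaryTriplet.exists_isMinimalSelfadjointDilation hS T_le_adjoint
    (fun _ => eq_zero_of_zero_mem_adjoint) isSimple_T hRe hWeyl hD hB

end Dilation

theorem theorem4p2 {H : Type*} [NormedAddCommGroup H] [InnerProductSpace ℂ H] [CompleteSpace H]
    (n : ℕ) (A B : H →ₗ.[ℂ] H)
    (hA : IsSelfAdjoint A) (hB : LinRel.IsMaximalDissipative B.graph)
    (hAB : ∃ (z : ℂ) (RA RB : H →L[ℂ] H),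
      LinRel.IsResolventAt A.graph z RA ∧ LinRel.IsResolventAt B.graph z RB ∧
      LinearMap.rank ((RB - RA : H →L[ℂ] H) : H →ₗ[ℂ] H) = (n : Cardinal))
    (Pi : BoundaryTriplet (A.graph ⊓ B.graph) (FirstOrder.Cn n))
    (D : Matrix (Fin n) (Fin n) ℂ)
    (hD : LinRel.IsDissipative (Matrix.toEuclideanLin D).graph)
    (hImD : LinearMap.ker (Matrix.toEuclideanLin (ℑ D : Matrix (Fin n) (Fin n) ℂ)) = ⊥)
    (hAΓ : A.graph = (LinearMap.ker Pi.Γ₀).map (Submodule.subtype _))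
    (hBΓ : B.graph =
      (LinearMap.ker (Pi.Γ₁ - Matrix.toEuclideanLin D ∘ₗ Pi.Γ₀)).map (Submodule.subtype _)) :
    ∃ L : WithLp 2 (H × FirstOrder.L2 n) →ₗ.[ℂ] WithLp 2 (H × FirstOrder.L2 n),
      L.graph = couplingRelation Pi D ∧ IsMinimalSelfadjointDilation L B :=
  theorem4p2_general (inf_le_left.trans (hAΓ.trans_le (Submodule.map_subtype_le _ _))) Pi hD hImD
    hBΓ
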